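/- **System.** There are a set $\mathcal R$ of readers, a totally ordered set $\mathcal W$ of writers (readers and writers are the clients) and $n$ servers, which communicate asynchronously by point-to-point messages; messages may be delayed arbitrarily. A client may fail at any time, for ever; it invokes a new operation only when its previous one is complete. A server is *active*, *crashed* or in *repair*. All servers are active initially; an active or repairing server may crash, and a crashed server may be triggered to start a repair, having lost its local state. Messages that reach a crashed server are lost. In a *group-send* a process sends a message to all $n$ servers, one after the other; if it fails or crashes meanwhile, only some of the messages are sent. A process that awaits responses counts only the responses to its current group-send. **Algorithm RADON-L.** Tags are pairs $(z,w)\in\mathbb N\times\mathcal W$ in lexicographic order. Each server stores a tag–value pair $(t_{loc},v_{loc})$, initially $(t_0,v_0)$. - *write($v$)* by $w$: group-send a tag query; await responses from a majority of the servers and let $t^*$ be the largest tag received; group-send $(\text{put-data},(t_w,v))$ with $t_w=(t^*.z+1,w)$; terminate after acks from $\lceil\frac{3n+1}{4}\rceil$ servers. - *read*: group-send a tag–value query; await responses from a majority and select the pair $(t_r,v_r)$ with the largest tag; group-send $(\text{put-data},(t_r,v_r))$; after acks from $\lceil\frac{3n+1}{4}\rceil$ servers return $v_r$. - *repair* of a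 crashed server: enter the repair state and set $(t_{loc},v_{loc})=(t_0,v_0)$; group-send a tag–value query; await responses from a majority, store the pair with the largest tag as $(t_{loc},v_{loc})$ and become active. - An active server answers a query with $t_{loc}$ or $(t_{loc},v_{loc})$ respectively; on $(\text{put-data},(t,v))$ it sets $(t_{loc},v_{loc})=(t,v)$ if $t>t_{loc}$, and sends an ack. A server that is not active does not react to such messages. **Condition N1 with parameter $\alpha$.** For every group-send in the execution whose sender sends all $n$ messages, there is a set of $\lceil\alpha n\rceil$ servers that all receive and process their messages from it and that all remain active from the invocation of the group-send until the last of them has processed its message. **Atomicity.** An execution is atomic if one can choose a set $\Phi$ of read and write operations, containing all complete and possibly some incomplete ones, and distinct points of time (serialization points) for the operations in $\Phi$, each after the invocation of its operation and, if the operation is complete, before its response, such that every complete read returns the value of the write in $\Phi$ with the last serialization point before that of the read, or $v_0$ if there is no such write. **Theorem.** Let $\alpha>\frac34$. Every (finite or infinite) execution of RADON-L that satisfies N1 with parameter $\alpha$ is atomic. -/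

import Mathlib

/-! ## Atomicity of a read/write object -/

/-- The external actions of a read/write object with readers `R`, writers `W` and values `V`. -/
inductive RWAction (R W V : Type*) where
  | invRead (r : R)
  | invWrite (w : W) (v : V)
  | retRead (r : R) (v : V)
  | retWrite (w : W)

namespace RWAction

variable {R W V : Type*}

/-- The client at which an action takes place. -/
def client : RWAction R W V → R ⊕ W
  | invRead r => .inl r
  | invWrite w _ => .inr w
  | retRead r _ => .inl r
  | retWrite w => .inr w

/-- The action is an invocation step. -/
def IsInv : RWAction R W V → Prop
  | invRead _ => True
  | invWrite _ _ => True
  | retRead _ _ => False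
  | retWrite _ => False

end RWAction

/-- A history: at every step of an execution, at most one external action. A finite history is
`none` from some step on. -/
abbrev RWHistory (R W V : Type*) := ℕ → Option (RWAction R W V)

namespace RWHistory

variable {R W V : Type*}

/-- The operation invoked at step `i` has its response at step `j`: `j` is the next action of the
same client, and it is a response. Operations are identified by their invocation steps. -/
def Completes (h : RWHistory R W V) (i j : ℕ) : Prop :=
  i < j ∧ ∃ a b : RWAction R W V, h i = some a ∧ h j = some b ∧ a.IsInv ∧ ¬ b.IsInv ∧
    b.client = a.client ∧
    ∀ k, i < k → k < j → ∀ d : RWAction R W V, h k = some d → d.client ≠ a.client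

/-- Step `i` invokes a write of the value `v`. -/
def WriteAt (h : RWHistory R W V) (i : ℕ) (v : V) : Prop :=
  ∃ w : W, h i = some (.invWrite w v)

/-- A history is atomic (for an object with initial value `v₀`) if one can choose a set `Φ` of
operations, containing all the complete ones and some of the incomplete ones, and distinct
serialization points `pt i` (real numbers; step `i` happens at the real time `i`) for the
operations in `Φ`, such that every serialization point lies after the invocation and, if the
operation is complete, before the response, and every complete read returns the value of the
write in `Φ` with the last serialization point before its own, or `v₀` if there is none. -/
def Atomic (v₀ : V) (h : RWHistory R W V) : Prop :=
  ∃ (Φ : Set ℕ) (pt : ℕ → ℝ),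
    (∀ i ∈ Φ, ∃ a : RWAction R W V, h i = some a ∧ a.IsInv) ∧
    (∀ i j, h.Completes i j → i ∈ Φ) ∧
    Set.InjOn pt Φ ∧
    (∀ i ∈ Φ, (i : ℝ) < pt i) ∧
    (∀ i j, h.Completes i j → pt i < (j : ℝ)) ∧
    (∀ i j r v, h.Completes i j → h j = some (.retRead r v) →
      (∃ k ∈ Φ, h.WriteAt k v ∧ pt k < pt i ∧
        ∀ l ∈ Φ, ∀ u, h.WriteAt l u → pt l < pt i → pt l ≤ pt k) ∨
      (v = v₀ ∧ ∀ l ∈ Φ, ∀ u, h.WriteAt l u → ¬ pt l < pt i))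

end RWHistory

/-! ## The algorithm RADON-L -/

namespace RadonL

/-- A tag `(z, w)`: a natural number and a writer, ordered lexicographically. -/
abbrev Tag (W : Type*) := ℕ ×ₗ W

/-- The processes: readers, writers and `n` servers. -/
inductive Proc (R W : Type*) (n : ℕ) where
  | reader (r : R)
  | writer (w : W)
  | server (s : Fin n)
  deriving DecidableEq

/-- Contents of a message that a process group-sends to the servers. -/
inductive Request (W V : Type*) where
  | queryTag
  | queryTagData
  | repairTagData
  | putData (t : Tag W) (v : V)

/-- Contents of a message that a server sends in response. -/
inductive Response (W V : Type*) where
  | tag (t : Tag W)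
  | tagData (t : Tag W) (v : V)
  | ack

/-- A message to a server. Every group-send operation has its own number `gid`, which the servers
copy to their responses; it tells the sender which of its requests a response answers. -/
structure ReqMsg (R W V : Type*) (n : ℕ) where
  gid : ℕ
  src : Proc R W n
  dst : Fin n
  body : Request W V

/-- A response from a server to the sender of the group-send operation number `gid`. -/
structure RespMsg (R W V : Type*) (n : ℕ) where
  gid : ℕ
  src : Fin n
  dst : Proc R W n
  body : Response W V

/-- The current group-send operation of a process: its number, the message, the servers to which
the message still has to be sent, and the responses received so far. -/
structure Call (W V : Type*) (n : ℕ) where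
  gid : ℕ
  req : Request W V
  unsent : Finset (Fin n)
  replies : Fin n → Option (Response W V)

namespace Call

variable {W V : Type*} {n : ℕ}

/-- The message has been sent to all the servers. -/
def Sent (c : Call W V n) : Prop := c.unsent = ∅

/-- The servers whose responses have been received. -/
def responders (c : Call W V n) : Finset (Fin n) :=
  Finset.univ.filter fun s => (c.replies s).isSome

/-- A majority of the servers has responded. -/
def Majority (c : Call W V n) : Prop := n < 2 * c.responders.card

/-- At least `⌈(3n + 1) / 4⌉` servers have responded. -/
def PutQuorum (c : Call W V n) : Prop := ⌈(3 * (n : ℝ) + 1) / 4⌉₊ ≤ c.responders.card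

/-- `t` is the largest among the tags received. -/
def IsMaxTag [LinearOrder W] (c : Call W V n) (t : Tag W) : Prop :=
  (∃ s, c.replies s = some (.tag t)) ∧ ∀ s t', c.replies s = some (.tag t') → t' ≤ t

/-- `(t, v)` has the largest tag among the pairs received. -/
def IsMaxTagData [LinearOrder W] (c : Call W V n) (t : Tag W) (v : V) : Prop :=
  (∃ s, c.replies s = some (.tagData t v)) ∧
    ∀ s t' v', c.replies s = some (.tagData t' v') → t' ≤ t

end Call

/-- The point of its program at which a reader is. -/
inductive ReaderPhase (W V : Type*) where
  | idle
  | getData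
  | putData (t : Tag W) (v : V)
  | failed

/-- The point of its program at which a writer is. -/
inductive WriterPhase (W V : Type*) where
  | idle
  | getTag (v : V)
  | putData (t : Tag W) (v : V)
  | failed

/-- The state of a server with respect to crash and repair. -/
inductive Status where
  | active
  | crashed
  | repair

/-- A global state. `loc s` is the pair `(t_loc, v_loc)` of the server `s`, `call p` is the current
group-send operation of the process `p`, `reqs` and `resps` are the messages in transit, and
`nextGid` is the number of the next group-send operation. -/
structure State (R W V : Type*) (n : ℕ) where
  reader : R → ReaderPhase W V
  writer : W → WriterPhase W V
  status : Fin n → Status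
  loc : Fin n → Tag W × V
  call : Proc R W n → Option (Call W V n)
  reqs : Set (ReqMsg R W V n)
  resps : Set (RespMsg R W V n)
  nextGid : ℕ

/-- The initial state, with initial tag `t₀` and initial value `v₀`. -/
def State.initial (R : Type*) {W V : Type*} (n : ℕ) (t₀ : Tag W) (v₀ : V) : State R W V n where
  reader := fun _ => .idle
  writer := fun _ => .idle
  status := fun _ => .active
  loc := fun _ => (t₀, v₀)
  call := fun _ => none
  reqs := ∅
  resps := ∅
  nextGid := 0

/-- The process `p` invokes the operation `group-send(q)`. The point-to-point messages are then
sent one by one. -/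
def State.groupSend {R W V : Type*} {n : ℕ} [DecidableEq R] [DecidableEq W] (σ : State R W V n)
    (p : Proc R W n) (q : Request W V) : State R W V n :=
  { σ with
    call := Function.update σ.call p (some ⟨σ.nextGid, q, Finset.univ, fun _ => none⟩)
    nextGid := σ.nextGid + 1 }

/-- The process `p` abandons or finishes its current group-send operation. -/
def State.endCall {R W V : Type*} {n : ℕ} [DecidableEq R] [DecidableEq W] (σ : State R W V n)
    (p : Proc R W n) : State R W V n :=
  { σ with call := Function.update σ.call p none }

/-- The local pair of an active server after a request. -/
def newLoc {W V : Type*} [LinearOrder W] (x : Tag W × V) : Request W V → Tag W × V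
  | .putData t v => if x.1 < t then (t, v) else x
  | _ => x

/-- The response of an active server with local pair `x` to a request. -/
def answer {W V : Type*} (x : Tag W × V) : Request W V → Response W V
  | .queryTag => .tag x.1
  | .queryTagData => .tagData x.1 x.2
  | .repairTagData => .tagData x.1 x.2
  | .putData _ _ => .ack

/-- The events. -/
inductive Event (R W V : Type*) (n : ℕ) where
  | invokeWrite (w : W) (v : V)
  | writerPut (w : W)
  | returnWrite (w : W)
  | invokeRead (r : R)
  | readerPut (r : R)
  | returnRead (r : R) (v : V)
  | failReader (r : R)
  | failWriter (w : W)
  | crash (s : Fin n)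
  | startRepair (s : Fin n)
  | finishRepair (s : Fin n)
  | send (p : Proc R W n) (s : Fin n)
  | recvReq (m : ReqMsg R W V n)
  | recvResp (m : RespMsg R W V n)

/-- The external action of an event, if it has one. -/
def Event.action {R W V : Type*} {n : ℕ} : Event R W V n → Option (RWAction R W V)
  | .invokeWrite w v => some (.invWrite w v)
  | .returnWrite w => some (.retWrite w)
  | .invokeRead r => some (.invRead r)
  | .returnRead r v => some (.retRead r v)
  | _ => none

/-- The process, if any, that invokes a group-send operation in an event. -/
def Event.groupSender {R W V : Type*} {n : ℕ} : Event R W V n → Option (Proc R W n)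
  | .invokeWrite w _ => some (.writer w)
  | .writerPut w => some (.writer w)
  | .invokeRead r => some (.reader r)
  | .readerPut r => some (.reader r)
  | .startRepair s => some (.server s)
  | _ => none

/-- The steps of RADON-L. A client invokes an operation only if it has no operation in progress. -/
inductive Step {R W V : Type*} {n : ℕ} [DecidableEq R] [LinearOrder W] (t₀ : Tag W) (v₀ : V) :
    State R W V n → Event R W V n → State R W V n → Prop
  /-- write, `get-tag` phase -/
  | invokeWrite (σ : State R W V n) (w : W) (v : V) (h : σ.writer w = .idle) :
      Step t₀ v₀ σ (.invokeWrite w v)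
        ({ σ with writer := Function.update σ.writer w (.getTag v) }.groupSend
          (.writer w) .queryTag)
  /-- write, `put-data` phase -/
  | writerPut (σ : State R W V n) (w : W) (v : V) (c : Call W V n) (t : Tag W)
      (h : σ.writer w = .getTag v) (hc : σ.call (.writer w) = some c) (hs : c.Sent)
      (hm : c.Majority) (ht : c.IsMaxTag t) :
      Step t₀ v₀ σ (.writerPut w)
        ({ σ with writer := Function.update σ.writer w
                      (.putData (toLex ((ofLex t).1 + 1, w)) v) }.groupSend
          (.writer w) (.putData (toLex ((ofLex t).1 + 1, w)) v))
  /-- termination of a write -/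
  | returnWrite (σ : State R W V n) (w : W) (t : Tag W) (v : V) (c : Call W V n)
      (h : σ.writer w = .putData t v) (hc : σ.call (.writer w) = some c) (hs : c.Sent)
      (hq : c.PutQuorum) :
      Step t₀ v₀ σ (.returnWrite w)
        ({ σ with writer := Function.update σ.writer w .idle }.endCall (.writer w))
  /-- read, `get-data` phase -/
  | invokeRead (σ : State R W V n) (r : R) (h : σ.reader r = .idle) :
      Step t₀ v₀ σ (.invokeRead r)
        ({ σ with reader := Function.update σ.reader r .getData }.groupSend
          (.reader r) .queryTagData)
  /-- read, `put-data` phase -/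
  | readerPut (σ : State R W V n) (r : R) (c : Call W V n) (t : Tag W) (v : V)
      (h : σ.reader r = .getData) (hc : σ.call (.reader r) = some c) (hs : c.Sent)
      (hm : c.Majority) (ht : c.IsMaxTagData t v) :
      Step t₀ v₀ σ (.readerPut r)
        ({ σ with reader := Function.update σ.reader r (.putData t v) }.groupSend
          (.reader r) (.putData t v))
  /-- termination of a read -/
  | returnRead (σ : State R W V n) (r : R) (t : Tag W) (v : V) (c : Call W V n)
      (h : σ.reader r = .putData t v) (hc : σ.call (.reader r) = some c) (hs : c.Sent)
      (hq : c.PutQuorum) :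
      Step t₀ v₀ σ (.returnRead r v)
        ({ σ with reader := Function.update σ.reader r .idle }.endCall (.reader r))
  /-- crash of a client, possibly in the middle of a group-send; it is permanent -/
  | failReader (σ : State R W V n) (r : R) :
      Step t₀ v₀ σ (.failReader r)
        ({ σ with reader := Function.update σ.reader r .failed }.endCall (.reader r))
  | failWriter (σ : State R W V n) (w : W) :
      Step t₀ v₀ σ (.failWriter w)
        ({ σ with writer := Function.update σ.writer w .failed }.endCall (.writer w))
  /-- crash of an active or repairing server -/
  | crash (σ : State R W V n) (s : Fin n) (h : σ.status s ≠ .crashed) :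
      Step t₀ v₀ σ (.crash s)
        ({ σ with status := Function.update σ.status s .crashed }.endCall (.server s))
  /-- start of a repair operation; the server has lost its local pair -/
  | startRepair (σ : State R W V n) (s : Fin n) (h : σ.status s = .crashed) :
      Step t₀ v₀ σ (.startRepair s)
        ({ σ with
            status := Function.update σ.status s .repair
            loc := Function.update σ.loc s (t₀, v₀) }.groupSend (.server s) .repairTagData)
  /-- end of a repair operation -/
  | finishRepair (σ : State R W V n) (s : Fin n) (c : Call W V n) (t : Tag W) (v : V)
      (h : σ.status s = .repair) (hc : σ.call (.server s) = some c) (hs : c.Sent)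
      (hm : c.Majority) (ht : c.IsMaxTagData t v) :
      Step t₀ v₀ σ (.finishRepair s)
        ({ σ with
            status := Function.update σ.status s .active
            loc := Function.update σ.loc s (t, v) }.endCall (.server s))
  /-- one of the point-to-point messages of a group-send is sent -/
  | send (σ : State R W V n) (p : Proc R W n) (s : Fin n) (c : Call W V n)
      (hc : σ.call p = some c) (hs : s ∈ c.unsent) :
      Step t₀ v₀ σ (.send p s)
        { σ with
          call := Function.update σ.call p (some { c with unsent := c.unsent.erase s })
          reqs := insert ⟨c.gid, p, s, c.req⟩ σ.reqs }
  /-- a request reaches an active server, which processes it and responds -/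
  | serve (σ : State R W V n) (m : ReqMsg R W V n) (hm : m ∈ σ.reqs)
      (h : σ.status m.dst = .active) :
      Step t₀ v₀ σ (.recvReq m)
        { σ with
          reqs := σ.reqs \ {m}
          loc := Function.update σ.loc m.dst (newLoc (σ.loc m.dst) m.body)
          resps := insert ⟨m.gid, m.dst, m.src, answer (σ.loc m.dst) m.body⟩ σ.resps }
  /-- a request reaches a server in the crashed or in the repair state and has no effect -/
  | ignore (σ : State R W V n) (m : ReqMsg R W V n) (hm : m ∈ σ.reqs)
      (h : σ.status m.dst ≠ .active) :
      Step t₀ v₀ σ (.recvReq m) { σ with reqs := σ.reqs \ {m} }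
  /-- a response reaches a process that is waiting for it -/
  | recvResp (σ : State R W V n) (m : RespMsg R W V n) (c : Call W V n) (hm : m ∈ σ.resps)
      (hc : σ.call m.dst = some c) (hg : c.gid = m.gid) :
      Step t₀ v₀ σ (.recvResp m)
        { σ with
          resps := σ.resps \ {m}
          call := Function.update σ.call m.dst
            (some { c with replies := Function.update c.replies m.src (some m.body) }) }
  /-- a response reaches a process that does not wait for it and has no effect -/
  | dropResp (σ : State R W V n) (m : RespMsg R W V n) (hm : m ∈ σ.resps)
      (hg : ∀ c, σ.call m.dst = some c → c.gid ≠ m.gid) :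
      Step t₀ v₀ σ (.recvResp m) { σ with resps := σ.resps \ {m} }

/-- A finite or infinite execution: `event i` leads from `state i` to `state (i + 1)`, and nothing
happens at the steps with `event i = none` (in a finite execution, from some step on). Messages may
be delayed for ever. -/
structure Execution (R W V : Type*) (n : ℕ) [DecidableEq R] [LinearOrder W]
    (t₀ : Tag W) (v₀ : V) where
  state : ℕ → State R W V n
  event : ℕ → Option (Event R W V n)
  start : state 0 = State.initial R n t₀ v₀
  step : ∀ i e, event i = some e → Step t₀ v₀ (state i) e (state (i + 1))
  stutter : ∀ i, event i = none → state (i + 1) = state i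

namespace Execution

variable {R W V : Type*} {n : ℕ} [DecidableEq R] [LinearOrder W] {t₀ : Tag W} {v₀ : V}

/-- The external actions of an execution. -/
def history (β : Execution R W V n t₀ v₀) : RWHistory R W V :=
  fun i => (β.event i).bind Event.action

/-- At step `i` the process `p` invokes the group-send operation number `g`. -/
def GroupSendAt (β : Execution R W V n t₀ v₀) (i : ℕ) (p : Proc R W n) (g : ℕ) : Prop :=
  (β.event i).bind Event.groupSender = some p ∧ (β.state i).nextGid = g

/-- The process `p` sends all the messages of its group-send operation number `g`. -/
def GroupSendDone (β : Execution R W V n t₀ v₀) (p : Proc R W n) (g : ℕ) : Prop :=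
  ∃ j c, (β.state j).call p = some c ∧ c.gid = g ∧ c.Sent

/-- At step `j` the server `s` receives and processes its message from the group-send operation
number `g`. -/
def ConsumesAt (β : Execution R W V n t₀ v₀) (j : ℕ) (s : Fin n) (g : ℕ) : Prop :=
  (β.state j).status s = .active ∧
    ∃ m : ReqMsg R W V n, β.event j = some (.recvReq m) ∧ m.dst = s ∧ m.gid = g

/-- The network stability condition N1 with parameter `α`: for every group-send operation whose
sender does not stop before sending all the messages, there are `⌈α n⌉` servers that all consume
their messages and that all remain active from the invocation of the group-send operation until the
last of them has consumed its message. -/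
def N1 (β : Execution R W V n t₀ v₀) (α : ℝ) : Prop :=
  ∀ i p g, β.GroupSendAt i p g → β.GroupSendDone p g →
    ∃ (A : Finset (Fin n)) (τ : Fin n → ℕ), A.card = ⌈α * (n : ℝ)⌉₊ ∧
      (∀ s ∈ A, β.ConsumesAt (τ s) s g) ∧
      ∀ s ∈ A, ∀ s' ∈ A, ∀ k, i ≤ k → k ≤ τ s' + 1 → (β.state k).status s = .active

end Execution

end RadonL

/-! Tag every operation that reaches its `put-data` phase with the tag that it puts. Atomicity
follows from four facts: tags respect the order of non-overlapping operations, strictly when the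
later one is a write; distinct writes have distinct tags; a read takes its pair from a write or from
the initial state; and the tags of writes exceed `t₀`. `RWHistory.atomic_of_tags` builds the
serialization points from these facts and does not involve the algorithm.

The first fact is the heart. Let an operation that puts `t` complete at step `j`, and let `A` be the
servers, more than three quarters of all, that N1 provides for its `put-data` message. If all of `A`
have consumed the message before `j`, then just after the last consumption all of `A` are active
with tags at least `t`. Otherwise `A` is active from the beginning of the phase up to `j`; those
members of `A` whose acks have arrived form a majority, as both sets have more than three quarters
of the servers, and having never crashed meanwhile they still hold tags at least `t`. Either way
(`PutAt.exists_majority`) there is a moment, not after `j`, at which some majority `M` is active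
with tags at least `t`.

This persists, although the servers of `M` may crash later in any number (`Step.stable`): a repair
of a server of `M` that starts after that moment hears from a majority, which meets `M`, and the
server of `M` in the intersection answered while active, with a tag at least `t`. So every member of
`M` is at or above `t` whenever it is active, and every query that starts after `j` sees a tag at
least `t`. Numbers of group-sends serve as a clock: those issued after the moment are the ones with
numbers from its `nextGid` on.

Two writes with the same tag have the same writer, whose operations are sequential, so the strict
inequality identifies them. The origin of the pairs is an invariant: only `writerPut` creates new
ones. -/

/-! ### Serialization points from tags -/

/-- Points of the real line for the elements of `Φ`, in the open intervals `(slot i - 1, slot i)`,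
ordered inside each interval by `key`. -/
theorem exists_points_of_slots {K : Type*} [LinearOrder K] (Φ : Set ℕ) (slot : ℕ → ℕ) (key : ℕ → K)
    (hslot : ∀ i ∈ Φ, i < slot i) :
    ∃ pt : ℕ → ℝ, (∀ i ∈ Φ, (i : ℝ) < pt i) ∧ (∀ i ∈ Φ, pt i < slot i) ∧
      ∀ i ∈ Φ, ∀ k ∈ Φ, slot i < slot k ∨ slot i = slot k ∧ key i < key k → pt i < pt k := by
  classical
  -- The range loses nothing, since every `k ∈ Φ` lies below its own slot. It contains `i`, which is
  -- not in `below i`; so the rank is less than `slot i`, and `(rank + 1) / (slot i + 1)` lies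
  -- strictly between 0 and 1.
  let below : ℕ → Finset ℕ := fun i =>
    (Finset.range (slot i)).filter fun k => k ∈ Φ ∧ slot k = slot i ∧ key k < key i
  have hcard : ∀ i ∈ Φ, (below i).card < slot i := by
    intro i hi
    have : below i ⊂ Finset.range (slot i) := by
      refine Finset.ssubset_iff_subset_ne.2 ⟨Finset.filter_subset _ _, fun h => ?_⟩
      have hmem : i ∈ below i := h ▸ Finset.mem_range.2 (hslot i hi)
      simp [below] at hmem
    simpa using Finset.card_lt_card this
  let pt : ℕ → ℝ := fun i => slot i - 1 + ((below i).card + 1) / (slot i + 1)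
  have hlow : ∀ i, (slot i : ℝ) - 1 < pt i := fun i => by
    have : (0 : ℝ) < ((below i).card + 1) / (slot i + 1) := by positivity
    simp only [pt]; linarith
  have hhigh : ∀ i ∈ Φ, pt i < slot i := fun i hi => by
    have h : ((below i).card : ℝ) < slot i := by exact_mod_cast hcard i hi
    have : (((below i).card : ℝ) + 1) / (slot i + 1) < 1 := by
      rw [div_lt_one (by positivity)]; linarith
    simp only [pt]; linarith
  refine ⟨pt, fun i hi => ?_, hhigh, ?_⟩
  · have : (i : ℝ) + 1 ≤ slot i := by exact_mod_cast hslot i hi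
    linarith [hlow i]
  · rintro i hi k hk (h | ⟨h, hkey⟩)
    · have : (slot i : ℝ) + 1 ≤ slot k := by exact_mod_cast h
      linarith [hhigh i hi, hlow k]
    · have hss : below i ⊂ below k := by
        refine Finset.ssubset_iff_subset_ne.2 ⟨fun l hl => ?_, fun he => ?_⟩
        · simp only [below, Finset.mem_filter, Finset.mem_range] at hl ⊢
          exact ⟨h ▸ hl.1, hl.2.1, hl.2.2.1.trans h, hl.2.2.2.trans hkey⟩
        · have hmem : i ∈ below k := by
            simp only [below, Finset.mem_filter, Finset.mem_range]
            exact ⟨h ▸ hslot i hi, hi, h, hkey⟩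
          rw [← he] at hmem
          simp [below] at hmem
      have hc : ((below i).card : ℝ) < (below k).card := by
        exact_mod_cast Finset.card_lt_card hss
      simp only [pt, h]
      gcongr

namespace RWHistory

variable {R W V T : Type*} [LinearOrder T]

/-- A history is atomic if its operations can be tagged in such a way that the tags respect the
order of non-overlapping operations, the tags of the writes are distinct and every read has the tag
of the write whose value it returns. The set `P` is the set of tagged operations. -/
theorem atomic_of_tags {v₀ : V} {h : RWHistory R W V} (P : Set ℕ) (tag : ℕ → T)
    (hinv : ∀ i ∈ P, ∃ a : RWAction R W V, h i = some a ∧ a.IsInv)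
    (hcompl : ∀ i j, h.Completes i j → i ∈ P)
    (hle : ∀ i j l, h.Completes i j → l ∈ P → j ≤ l → tag i ≤ tag l)
    (hlt : ∀ i j l u, h.Completes i j → l ∈ P → j ≤ l → h.WriteAt l u → tag i < tag l)
    (huniq : ∀ k ∈ P, ∀ l ∈ P, ∀ u v, h.WriteAt k u → h.WriteAt l v → tag k = tag l → k = l)
    (hread : ∀ i j r v, h.Completes i j → h j = some (.retRead r v) →
      (∃ k ∈ P, h.WriteAt k v ∧ tag k = tag i) ∨
        (v = v₀ ∧ ∀ l ∈ P, ∀ u, h.WriteAt l u → tag i < tag l)) :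
    h.Atomic v₀ := by
  classical
  -- `D t` is the first response of an operation with a tag at least `t`, the deadline for a write
  -- with tag `t` to take effect.
  let E : T → Set ℕ := fun t => {j | ∃ i, h.Completes i j ∧ t ≤ tag i}
  let D : T → ℕ := fun t => sInf (E t)
  -- The term `i + 1` matters only for operations invoked at or after their deadline; by `hslotw`
  -- these are never writes.
  let slot : ℕ → ℕ := fun i => max (D (tag i)) (i + 1)
  let isWrite : ℕ → Prop := fun i => ∃ u, h.WriteAt i u
  -- Within a slot a write precedes the reads with its tag; the index `i` only makes the keys
  -- distinct.
  let key : ℕ → T ×ₗ ℕ ×ₗ ℕ := fun i =>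
    toLex (tag i, toLex ((if isWrite i then 0 else 1 : ℕ), i))
  -- Operations with tags above those of all complete operations are dropped. For the others `D` is
  -- a true minimum and not the default value `sInf ∅ = 0`.
  let Φ : Set ℕ := {i | i ∈ P ∧ (E (tag i)).Nonempty}
  have hE : ∀ i j, h.Completes i j → j ∈ E (tag i) := fun i j hij => ⟨i, hij, le_rfl⟩
  have hΦ : ∀ i j, h.Completes i j → i ∈ Φ := fun i j hij => ⟨hcompl i j hij, j, hE i j hij⟩
  have hDmono : ∀ t t', t ≤ t' → (E t').Nonempty → D t ≤ D t' := by
    intro t t' ht hne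
    obtain ⟨i, hi, hi'⟩ := Nat.sInf_mem hne
    exact Nat.sInf_le ⟨i, hi, ht.trans hi'⟩
  -- An operation invoked at or after the deadline of `tag l` follows a complete operation with a
  -- tag at least `tag l`, so its own tag is not smaller.
  have hafter : ∀ l i, l ∈ Φ → i ∈ P → tag i < tag l → i < D (tag l) := by
    intro l i hl hi hlt'
    obtain ⟨i', hi', hi''⟩ := Nat.sInf_mem hl.2
    by_contra hcon
    exact absurd (hi''.trans (hle i' _ i hi' hi (not_lt.1 hcon))) (not_le.2 hlt')
  -- A write invoked at or after its own deadline would have a tag larger than itself.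
  have hslotw : ∀ l ∈ Φ, ∀ u, h.WriteAt l u → slot l = D (tag l) := by
    intro l hl u hu
    obtain ⟨i', hi', hi''⟩ := Nat.sInf_mem hl.2
    refine max_eq_left ?_
    by_contra hcon
    have := hlt i' _ l u hi' hl.1 (by simp only [D] at hcon; omega) hu
    exact absurd hi'' (not_le.2 this)
  obtain ⟨pt, hpt1, hpt2, hpt3⟩ := exists_points_of_slots Φ slot key
    (fun i _ => lt_of_lt_of_le (Nat.lt_succ_self i) (le_max_right _ _))
  have hlater : ∀ i ∈ Φ, ∀ l ∈ Φ, ∀ u, h.WriteAt l u → tag i < tag l → pt i < pt l := by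
    intro i hi l hl u hu hil
    have h1 : slot i ≤ slot l := by
      rw [hslotw l hl u hu]
      exact max_le (hDmono _ _ hil.le hl.2) (hafter l i hl hi.1 hil)
    refine hpt3 i hi l hl ?_
    rcases h1.lt_or_eq with h1 | h1
    · exact Or.inl h1
    · exact Or.inr ⟨h1, Prod.Lex.toLex_lt_toLex.2 (Or.inl hil)⟩
  refine ⟨Φ, pt, fun i hi => hinv i hi.1, hΦ, ?_, hpt1, ?_, ?_⟩
  · intro i hi k hk hik
    by_contra hne
    have hkne : key i ≠ key k := fun he => hne (by
      have := congrArg (fun x => (ofLex (ofLex x).2).2) he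
      simpa [key] using this)
    rcases lt_trichotomy (slot i) (slot k) with hs | hs | hs
    · exact (hpt3 i hi k hk (Or.inl hs)).ne hik
    · rcases hkne.lt_or_gt with hk' | hk'
      · exact (hpt3 i hi k hk (Or.inr ⟨hs, hk'⟩)).ne hik
      · exact (hpt3 k hk i hi (Or.inr ⟨hs.symm, hk'⟩)).ne hik.symm
    · exact (hpt3 k hk i hi (Or.inl hs)).ne hik.symm
  · intro i j hij
    refine (hpt2 i (hΦ i j hij)).trans_le ?_
    have : slot i ≤ j := max_le (Nat.sInf_le (hE i j hij)) hij.1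
    exact_mod_cast this
  · intro i j r v hij hj
    have hi := hΦ i j hij
    rcases hread i j r v hij hj with ⟨k, hkP, hk, htag⟩ | ⟨hv, hall⟩
    · have hkΦ : k ∈ Φ := ⟨hkP, htag ▸ hi.2⟩
      refine Or.inl ⟨k, hkΦ, hk, ?_, fun l hl u hu hli => ?_⟩
      · have hs : slot k ≤ slot i := by
          rw [hslotw k hkΦ v hk, htag]; exact le_max_left _ _
        refine hpt3 k hkΦ i hi ?_
        rcases hs.lt_or_eq with hs | hs
        · exact Or.inl hs
        · refine Or.inr ⟨hs, Prod.Lex.toLex_lt_toLex.2 (Or.inr ⟨htag, ?_⟩)⟩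
          have hnw : ¬ isWrite i := by
            rintro ⟨u, w, hw⟩
            obtain ⟨-, a, b, ha, hb, -, -, hc, -⟩ := hij
            rw [hw] at ha; rw [hj] at hb
            cases ha; cases hb
            simp [RWAction.client] at hc
          have hw : isWrite k := ⟨v, hk⟩
          refine Prod.Lex.toLex_lt_toLex.2 (Or.inl ?_)
          simp [hnw, hw]
      · rcases lt_trichotomy (tag l) (tag k) with hlk | hlk | hlk
        · exact (hlater l hl k hkΦ v hk hlk).le
        · rw [huniq l hl.1 k hkP u v hu hk hlk]
        · exact absurd (hlater i hi l hl u hu (htag ▸ hlk)) hli.not_gt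
    · exact Or.inr ⟨hv, fun l hl u hu =>
        (hlater i hi l hl u hu (hall l hl.1 u hu)).not_gt⟩

end RWHistory

/-! ### Steps as seen by a client -/

/-- The value that an action writes, if it is the invocation of a write. -/
def RWAction.written {R W V : Type*} : RWAction R W V → Option V
  | .invWrite _ v => some v
  | _ => none

namespace RadonL

variable {R W V : Type*} {n : ℕ}

/-- The point of its program at which a client (reader or writer) is. -/
inductive ClientPhase (W V : Type*) where
  | idle
  | get (x : Option V)
  | put (t : Tag W) (v : V)
  | failed

/-- The phase of a reader as a client. -/
def ReaderPhase.toClient : ReaderPhase W V → ClientPhase W V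
  | .idle => .idle
  | .getData => .get none
  | .putData t v => .put t v
  | .failed => .failed

/-- The phase of a writer as a client. -/
def WriterPhase.toClient : WriterPhase W V → ClientPhase W V
  | .idle => .idle
  | .getTag v => .get (some v)
  | .putData t v => .put t v
  | .failed => .failed

/-- The process that a client is. -/
def clientProc (n : ℕ) : R ⊕ W → Proc R W n
  | .inl r => .reader r
  | .inr w => .writer w

/-- The phase of a client. -/
def State.phase (σ : State R W V n) : R ⊕ W → ClientPhase W V
  | .inl r => (σ.reader r).toClient
  | .inr w => (σ.writer w).toClient

/-- The query that a client group-sends in its first phase. -/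
def clientQuery (V : Type*) : R ⊕ W → Request W V
  | .inl _ => .queryTagData
  | .inr _ => .queryTag

/-- The pair `(t, v)` is a legitimate choice for the `put-data` phase of a client that intends to
write `x` (or to read, if `x` is `none`) and has received the replies to the call `c`. -/
def Selects [LinearOrder W] (c : Call W V n) (t : Tag W) (v : V) (x : Option V) : R ⊕ W → Prop
  | .inl _ => c.IsMaxTagData t v
  | .inr w => x = some v ∧ ∃ t', c.IsMaxTag t' ∧ t = toLex ((ofLex t').1 + 1, w)

/-- What a step of RADON-L with the external action `act` and the group-sender `sender` (if any) does
to a client. -/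
inductive ClientStep [LinearOrder W] (σ : State R W V n) (act : Option (RWAction R W V))
    (sender : Option (Proc R W n)) (σ' : State R W V n) (p : R ⊕ W) : Prop
  | other (hphase : σ'.phase p = σ.phase p)
      (hcall : ∀ c, σ.call (clientProc n p) = some c →
        ∃ c', σ'.call (clientProc n p) = some c' ∧ c'.gid = c.gid)
      (haction : ∀ a, act = some a → a.client ≠ p)
  | invoke (a : RWAction R W V) (haction : act = some a) (hp : a.client = p) (hinv : a.IsInv)
      (hphase : σ.phase p = .idle) (hphase' : σ'.phase p = .get a.written)
      (hcall : σ'.call (clientProc n p) =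
        some ⟨σ.nextGid, clientQuery V p, Finset.univ, fun _ => none⟩)
  | put (x : Option V) (t : Tag W) (v : V) (c : Call W V n) (haction : act = none)
      (hsender : sender = some (clientProc n p)) (hphase : σ.phase p = .get x)
      (hphase' : σ'.phase p = .put t v) (hcall : σ.call (clientProc n p) = some c)
      (hmaj : c.Majority) (hsel : Selects c t v x p)
      (hcall' : σ'.call (clientProc n p) =
        some ⟨σ.nextGid, .putData t v, Finset.univ, fun _ => none⟩)
  | respond (a : RWAction R W V) (t : Tag W) (v : V) (c : Call W V n) (haction : act = some a)
      (hp : a.client = p) (hinv : ¬ a.IsInv) (hphase : σ.phase p = .put t v)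
      (hphase' : σ'.phase p = .idle) (hcall : σ.call (clientProc n p) = some c) (hsent : c.Sent)
      (hquorum : c.PutQuorum) (hvalue : ∀ r u, a = .retRead r u → u = v)
  | fail (haction : act = none) (hphase' : σ'.phase p = .failed)

/-- Readers and writers run the same two-phase program, so one case analysis here serves for both.
In the case `other` only the number of the call is kept, because `send` and `recvResp` change the
call itself. -/
theorem Step.clientStep [DecidableEq R] [LinearOrder W] {t₀ : Tag W} {v₀ : V}
    {σ σ' : State R W V n} {e : Event R W V n} (h : Step t₀ v₀ σ e σ') (p : R ⊕ W) :
    ClientStep σ e.action e.groupSender σ' p := by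
  have other_of (h1 : σ'.phase p = σ.phase p)
      (h2 : σ'.call (clientProc n p) = σ.call (clientProc n p))
      (h3 : ∀ a, e.action = some a → a.client ≠ p) : ClientStep σ e.action e.groupSender σ' p :=
    .other h1 (fun c hc => ⟨c, h2.trans hc, rfl⟩) h3
  cases h with
  | invokeWrite w v h =>
    by_cases hp : p = .inr w
    · subst hp
      refine .invoke _ rfl rfl trivial ?_ ?_ ?_ <;>
        simp [State.phase, State.groupSend, h, WriterPhase.toClient, RWAction.written, clientProc,
          clientQuery]
    · refine other_of ?_ ?_ ?_ <;> rcases p with r | w' <;>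
        simp_all [State.phase, State.groupSend, clientProc, Event.action, RWAction.client,
          eq_comm]
  | writerPut w v c t h hc hs hm ht =>
    by_cases hp : p = .inr w
    · subst hp
      refine .put (some v) (toLex ((ofLex t).1 + 1, w)) v c rfl rfl ?_ ?_ hc hm ⟨rfl, t, ht, rfl⟩ ?_
        <;> simp [State.phase, State.groupSend, h, WriterPhase.toClient, clientProc]
    · refine other_of ?_ ?_ ?_ <;> rcases p with r | w' <;>
        simp_all [State.phase, State.groupSend, clientProc, Event.action]
  | returnWrite w t v c h hc hs hq =>
    by_cases hp : p = .inr w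
    · subst hp
      refine .respond _ t v c rfl rfl id ?_ ?_ hc hs hq (by simp) <;>
        simp [State.phase, State.endCall, h, WriterPhase.toClient]
    · refine other_of ?_ ?_ ?_ <;> rcases p with r | w' <;>
        simp_all [State.phase, State.endCall, clientProc, Event.action, RWAction.client, eq_comm]
  | invokeRead r h =>
    by_cases hp : p = .inl r
    · subst hp
      refine .invoke _ rfl rfl trivial ?_ ?_ ?_ <;>
        simp [State.phase, State.groupSend, h, ReaderPhase.toClient, RWAction.written, clientProc,
          clientQuery]
    · refine other_of ?_ ?_ ?_ <;> rcases p with r' | w <;>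
        simp_all [State.phase, State.groupSend, clientProc, Event.action, RWAction.client,
          eq_comm]
  | readerPut r c t v h hc hs hm ht =>
    by_cases hp : p = .inl r
    · subst hp
      refine .put none t v c rfl rfl ?_ ?_ hc hm ht ?_
        <;> simp [State.phase, State.groupSend, h, ReaderPhase.toClient, clientProc]
    · refine other_of ?_ ?_ ?_ <;> rcases p with r' | w <;>
        simp_all [State.phase, State.groupSend, clientProc, Event.action]
  | returnRead r t v c h hc hs hq =>
    by_cases hp : p = .inl r
    · subst hp
      refine .respond _ t v c rfl rfl id ?_ ?_ hc hs hq (by simp) <;>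
        simp [State.phase, State.endCall, h, ReaderPhase.toClient]
    · refine other_of ?_ ?_ ?_ <;> rcases p with r' | w <;>
        simp_all [State.phase, State.endCall, clientProc, Event.action, RWAction.client, eq_comm]
  | failReader r =>
    by_cases hp : p = .inl r
    · subst hp
      exact .fail rfl (by simp [State.phase, State.endCall, ReaderPhase.toClient])
    · refine other_of ?_ ?_ ?_ <;> rcases p with r' | w <;>
        simp_all [State.phase, State.endCall, clientProc, Event.action]
  | failWriter w =>
    by_cases hp : p = .inr w
    · subst hp
      exact .fail rfl (by simp [State.phase, State.endCall, WriterPhase.toClient])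
    · refine other_of ?_ ?_ ?_ <;> rcases p with r' | w <;>
        simp_all [State.phase, State.endCall, clientProc, Event.action]
  | crash s h =>
    refine other_of ?_ ?_ ?_ <;> cases p <;>
      simp [State.phase, State.endCall, clientProc, Event.action]
  | startRepair s h =>
    refine other_of ?_ ?_ ?_ <;> cases p <;>
      simp [State.phase, State.groupSend, clientProc, Event.action]
  | finishRepair s c t v h hc hs hm ht =>
    refine other_of ?_ ?_ ?_ <;> cases p <;>
      simp [State.phase, State.endCall, clientProc, Event.action]
  | send q s c hc hs =>
    refine .other (by cases p <;> rfl) (fun c' hc' => ?_) (by simp [Event.action])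
    by_cases hq : clientProc n p = q
    · subst hq
      cases hc.symm.trans hc'
      exact ⟨_, Function.update_self .., rfl⟩
    · exact ⟨c', by simpa [hq] using hc', rfl⟩
  | serve m hm h =>
    exact other_of (by cases p <;> rfl) rfl (by simp [Event.action])
  | ignore m hm h =>
    exact other_of (by cases p <;> rfl) rfl (by simp [Event.action])
  | recvResp m c hm hc hg =>
    refine .other (by cases p <;> rfl) (fun c' hc' => ?_) (by simp [Event.action])
    by_cases hq : clientProc n p = m.dst
    · rw [hq] at hc' ⊢
      cases hc.symm.trans hc'
      exact ⟨_, Function.update_self .., rfl⟩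
    · exact ⟨c', by simpa [hq] using hc', rfl⟩
  | dropResp m hm hg =>
    exact other_of (by cases p <;> rfl) rfl (by simp [Event.action])

end RadonL

/-! ### Invariants of messages, calls and servers -/

namespace RadonL

variable {R W V : Type*} {n : ℕ}

/-- What a step of RADON-L does to the messages in transit and to the current calls. -/
inductive NetStep [DecidableEq R] [LinearOrder W] (σ σ' : State R W V n) : Prop
  | groupSend (p : Proc R W n) (q : Request W V)
      (hcall : σ'.call =
        Function.update σ.call p (some ⟨σ.nextGid, q, Finset.univ, fun _ => none⟩))
      (hreqs : σ'.reqs = σ.reqs) (hresps : σ'.resps = σ.resps)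
      (hgid : σ'.nextGid = σ.nextGid + 1)
  | endCall (p : Proc R W n) (hcall : σ'.call = Function.update σ.call p none)
      (hreqs : σ'.reqs = σ.reqs) (hresps : σ'.resps = σ.resps) (hgid : σ'.nextGid = σ.nextGid)
  | send (p : Proc R W n) (s : Fin n) (c : Call W V n) (hc : σ.call p = some c)
      (hcall : σ'.call =
        Function.update σ.call p (some { c with unsent := c.unsent.erase s }))
      (hreqs : σ'.reqs = insert ⟨c.gid, p, s, c.req⟩ σ.reqs) (hresps : σ'.resps = σ.resps)
      (hgid : σ'.nextGid = σ.nextGid)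
  | serve (m : ReqMsg R W V n) (hm : m ∈ σ.reqs) (hact : σ.status m.dst = .active)
      (hcall : σ'.call = σ.call) (hreqs : σ'.reqs ⊆ σ.reqs)
      (hresps : σ'.resps =
        insert ⟨m.gid, m.dst, m.src, answer (σ.loc m.dst) m.body⟩ σ.resps)
      (hloc : σ'.loc = Function.update σ.loc m.dst (newLoc (σ.loc m.dst) m.body))
      (hgid : σ'.nextGid = σ.nextGid)
  | recvResp (m : RespMsg R W V n) (c : Call W V n) (hm : m ∈ σ.resps)
      (hc : σ.call m.dst = some c) (hg : c.gid = m.gid)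
      (hcall : σ'.call = Function.update σ.call m.dst
        (some { c with replies := Function.update c.replies m.src (some m.body) }))
      (hreqs : σ'.reqs = σ.reqs) (hresps : σ'.resps ⊆ σ.resps)
      (hgid : σ'.nextGid = σ.nextGid)
  | drop (hcall : σ'.call = σ.call) (hreqs : σ'.reqs ⊆ σ.reqs) (hresps : σ'.resps ⊆ σ.resps)
      (hgid : σ'.nextGid = σ.nextGid)

/-- The numbers of all the group-send operations in use are below the next number. -/
structure State.Bounded (σ : State R W V n) : Prop where
  reqs : ∀ m ∈ σ.reqs, m.gid < σ.nextGid
  resps : ∀ m ∈ σ.resps, m.gid < σ.nextGid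
  call : ∀ p c, σ.call p = some c → c.gid < σ.nextGid

/-- The group-send operation number `g` has the message `q`, and all the responses to it are
answers to `q`. -/
structure State.Carries (σ : State R W V n) (q : Request W V) (g : ℕ) : Prop where
  lt : g < σ.nextGid
  reqs : ∀ m ∈ σ.reqs, m.gid = g → m.body = q
  resps : ∀ m ∈ σ.resps, m.gid = g → ∃ x, m.body = answer x q
  call : ∀ p c, σ.call p = some c → c.gid = g →
    c.req = q ∧ ∀ s b, c.replies s = some b → ∃ x, b = answer x q

/-- The tag in a response, if there is one, is at least `t`. -/
def Response.AtLeast [LinearOrder W] (t : Tag W) : Response W V → Prop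
  | .tag t' => t ≤ t'
  | .tagData t' _ => t ≤ t'
  | .ack => True

theorem answer_atLeast [LinearOrder W] {t : Tag W} {x : Tag W × V} (h : t ≤ x.1)
    (q : Request W V) : (answer x q).AtLeast t := by
  cases q <;> simp [answer, Response.AtLeast, h]

theorem le_newLoc [LinearOrder W] (x : Tag W × V) (q : Request W V) : x.1 ≤ (newLoc x q).1 := by
  cases q with
  | putData t v =>
    by_cases h : x.1 < t
    · simp [newLoc, h, h.le]
    · simp [newLoc, h]
  | _ => exact le_rfl

theorem le_newLoc_putData [LinearOrder W] (x : Tag W × V) (t : Tag W) (v : V) :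
    t ≤ (newLoc x (.putData t v)).1 := by
  by_cases h : x.1 < t
  · simp [newLoc, h]
  · simpa only [newLoc, h, if_false] using not_lt.1 h

/-- All the servers of `M` have a tag of at least `t` whenever they are active, and so have all
their answers to the group-send operations with numbers from `g` on. -/
structure State.Stable [LinearOrder W] (t : Tag W) (M : Finset (Fin n)) (g : ℕ)
    (σ : State R W V n) : Prop where
  le_nextGid : g ≤ σ.nextGid
  loc : ∀ s ∈ M, σ.status s = .active → t ≤ (σ.loc s).1
  resps : ∀ m ∈ σ.resps, m.src ∈ M → g ≤ m.gid → m.body.AtLeast t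
  replies : ∀ p c, σ.call p = some c → g ≤ c.gid →
    ∀ s ∈ M, ∀ b, c.replies s = some b → b.AtLeast t
  repair : ∀ s ∈ M, σ.status s = .repair →
    ∃ c, σ.call (.server s) = some c ∧ g ≤ c.gid ∧ σ.Carries .repairTagData c.gid

/-- If the server `s` has answered the group-send operation number `g`, its tag is at least `t`. -/
structure State.Covered [LinearOrder W] (t : Tag W) (g : ℕ) (s : Fin n)
    (σ : State R W V n) : Prop where
  resps : ∀ m ∈ σ.resps, m.src = s → m.gid = g → t ≤ (σ.loc s).1
  replies : ∀ p c, σ.call p = some c → c.gid = g → (c.replies s).isSome → t ≤ (σ.loc s).1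

/-- Two majorities meet. `Carries` makes the common reply an answer to `q`; when `q` is a query,
this excludes `ack`, for which `AtLeast` is void. -/
theorem State.Stable.exists_reply [LinearOrder W] {σ : State R W V n}
    {t : Tag W} {M : Finset (Fin n)} {g : ℕ} (hσ : σ.Stable t M g)
    (hM : n < 2 * M.card) {p : Proc R W n} {c : Call W V n} {q : Request W V}
    (hc : σ.call p = some c) (hg : g ≤ c.gid) (hq : σ.Carries q c.gid) (hmaj : c.Majority) :
    ∃ s x, c.replies s = some (answer x q) ∧ (answer x q).AtLeast t := by
  have hne : (M ∩ c.responders).Nonempty := by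
    have h1 := Finset.card_union_add_card_inter M c.responders
    have h2 := Finset.card_le_univ (M ∪ c.responders)
    rw [Fintype.card_fin] at h2
    rw [← Finset.card_pos]
    unfold Call.Majority at hmaj
    omega
  obtain ⟨s, hs⟩ := hne
  rw [Finset.mem_inter, Call.responders, Finset.mem_filter] at hs
  obtain ⟨b, hb⟩ := Option.isSome_iff_exists.1 hs.2.2
  obtain ⟨x, rfl⟩ := (hq.call p c hc rfl).2 s b hb
  exact ⟨s, x, hb, hσ.replies p c hc hg s hs.1 _ hb⟩

variable [DecidableEq R] [LinearOrder W] {t₀ : Tag W} {v₀ : V} {σ σ' : State R W V n}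
  {e : Event R W V n}

theorem Step.netStep (h : Step t₀ v₀ σ e σ') : NetStep σ σ' := by
  cases h with
  | invokeWrite | writerPut | invokeRead | readerPut | startRepair =>
    exact .groupSend _ _ rfl rfl rfl rfl
  | returnWrite | returnRead | failReader | failWriter | crash | finishRepair =>
    exact .endCall _ rfl rfl rfl rfl
  | send p s c hc hs => exact .send p s c hc rfl rfl rfl rfl
  | serve m hm h => exact .serve m hm h rfl Set.sdiff_subset rfl rfl rfl
  | ignore m hm h => exact .drop rfl Set.sdiff_subset subset_rfl rfl
  | recvResp m c hm hc hg => exact .recvResp m c hm hc hg rfl rfl Set.sdiff_subset rfl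
  | dropResp m hm hg => exact .drop rfl subset_rfl Set.sdiff_subset rfl

theorem Step.nextGid_le (h : Step t₀ v₀ σ e σ') : σ.nextGid ≤ σ'.nextGid := by
  cases h.netStep <;> omega

theorem Step.bounded (h : Step t₀ v₀ σ e σ') (hσ : σ.Bounded) : σ'.Bounded := by
  obtain ⟨h1, h2, h3⟩ := hσ
  cases h.netStep with
  | groupSend p q hcall hreqs hresps hgid =>
    refine ⟨?_, ?_, ?_⟩
    · grind
    · grind
    · intro p' c hc
      rw [hcall, Function.update_apply] at hc
      grind
  | endCall p hcall hreqs hresps hgid =>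
    refine ⟨by grind, by grind, fun p' c hc => ?_⟩
    rw [hcall, Function.update_apply] at hc
    grind
  | send p s c hc hcall hreqs hresps hgid =>
    have := h3 p c hc
    refine ⟨?_, by grind, fun p' c hc => ?_⟩
    · intro m hm
      rw [hreqs] at hm
      rcases hm with rfl | hm
      · simpa [hgid] using this
      · exact hgid ▸ h1 m hm
    · rw [hcall, Function.update_apply] at hc
      grind
  | serve m hm hact hcall hreqs hresps hloc hgid =>
    refine ⟨fun m hm => hgid ▸ h1 m (hreqs hm), fun m' hm' => ?_,
      fun p c hc => hgid ▸ h3 p c (hcall ▸ hc)⟩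
    rw [hresps] at hm'
    rcases hm' with rfl | hm'
    · simpa [hgid] using h1 m hm
    · exact hgid ▸ h2 m' hm'
  | recvResp m c hm hc hg hcall hreqs hresps hgid =>
    have := h3 _ c hc
    refine ⟨by grind, fun m hm => hgid ▸ h2 m (hresps hm), fun p' c hc => ?_⟩
    rw [hcall, Function.update_apply] at hc
    grind
  | drop hcall hreqs hresps hgid =>
    exact ⟨fun m hm => hgid ▸ h1 m (hreqs hm), fun m hm => hgid ▸ h2 m (hresps hm),
      fun p c hc => hgid ▸ h3 p c (hcall ▸ hc)⟩

/-- Requests and responses copy the number of their call, and a new call gets the number `nextGid`,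
which differs from `g`. -/
theorem Step.carries (h : Step t₀ v₀ σ e σ') {q : Request W V} {g : ℕ} (hσ : σ.Carries q g) :
    σ'.Carries q g := by
  obtain ⟨h0, h1, h2, h3⟩ := hσ
  cases h.netStep with
  | groupSend p q hcall hreqs hresps hgid =>
    refine ⟨by omega, by grind, by grind, fun p' c hc hg => ?_⟩
    rw [hcall, Function.update_apply] at hc
    split at hc
    · cases hc; exact absurd hg h0.ne'
    · exact h3 p' c hc hg
  | endCall p hcall hreqs hresps hgid =>
    refine ⟨by omega, by grind, by grind, fun p' c hc hg => ?_⟩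
    rw [hcall, Function.update_apply] at hc
    split at hc
    · cases hc
    · exact h3 p' c hc hg
  | send p s c hc hcall hreqs hresps hgid =>
    refine ⟨by omega, fun m hm hg => ?_, by grind, fun p' c' hc' hg => ?_⟩
    · rw [hreqs] at hm
      rcases hm with rfl | hm
      · exact (h3 p c hc hg).1
      · exact h1 m hm hg
    · rw [hcall, Function.update_apply] at hc'
      split at hc'
      · cases hc'; exact h3 p c hc hg
      · exact h3 p' c' hc' hg
  | serve m hm hact hcall hreqs hresps hloc hgid =>
    refine ⟨by omega, fun m hm => h1 m (hreqs hm), fun m' hm' hg => ?_,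
      fun p c hc => h3 p c (hcall ▸ hc)⟩
    rw [hresps] at hm'
    rcases hm' with rfl | hm'
    · exact ⟨σ.loc m.dst, by rw [h1 m hm hg]⟩
    · exact h2 m' hm' hg
  | recvResp m c hm hc hg hcall hreqs hresps hgid =>
    refine ⟨by omega, by grind, fun m hm => h2 m (hresps hm), fun p' c' hc' hg' => ?_⟩
    rw [hcall, Function.update_apply] at hc'
    split at hc'
    · cases hc'
      refine ⟨(h3 _ c hc hg').1, fun s b hb => ?_⟩
      simp only [Function.update_apply] at hb
      split at hb
      · cases hb; exact h2 m hm (hg.symm.trans hg')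
      · exact (h3 _ c hc hg').2 s b hb
    · exact h3 p' c' hc' hg'
  | drop hcall hreqs hresps hgid =>
    exact ⟨by omega, fun m hm => h1 m (hreqs hm), fun m hm => h2 m (hresps hm),
      fun p c hc => h3 p c (hcall ▸ hc)⟩

/-- A new group-send operation carries its message. -/
theorem Step.carries_new (h : Step t₀ v₀ σ e σ') (hσ : σ.Bounded) {p : Proc R W n}
    {c : Call W V n} (hc : σ'.call p = some c) (hg : c.gid = σ.nextGid) :
    σ'.Carries c.req c.gid := by
  obtain ⟨h1, h2, h3⟩ := hσ
  have hne : ∀ p c', σ.call p = some c' → c'.gid ≠ c.gid := fun p c' hc' =>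
    hg ▸ (h3 p c' hc').ne
  cases h.netStep with
  | groupSend p' q hcall hreqs hresps hgid =>
    rw [hcall, Function.update_apply] at hc
    split at hc
    · cases hc
      refine ⟨by simp [hgid], fun m hm hg => absurd hg ?_, fun m hm hg => absurd hg ?_,
        fun p'' c' hc' hg' => ?_⟩
      · exact (h1 m (hreqs ▸ hm)).ne
      · exact (h2 m (hresps ▸ hm)).ne
      · rw [hcall, Function.update_apply] at hc'
        split at hc'
        · cases hc'
          exact ⟨rfl, by simp⟩
        · exact absurd hg' (hne _ _ hc')
    · exact absurd rfl (hne _ _ hc)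
  | endCall p' hcall hreqs hresps hgid =>
    rw [hcall, Function.update_apply] at hc
    grind
  | send p' s c' hc' hcall hreqs hresps hgid =>
    rw [hcall, Function.update_apply] at hc
    grind
  | serve m hm hact hcall hreqs hresps hloc hgid => exact absurd rfl (hne p c (hcall ▸ hc))
  | recvResp m c' hm hc' hg' hcall hreqs hresps hgid =>
    rw [hcall, Function.update_apply] at hc
    grind
  | drop hcall hreqs hresps hgid => exact absurd rfl (hne p c (hcall ▸ hc))

/-- The tag of an active server does not decrease. -/
theorem Step.loc_le (h : Step t₀ v₀ σ e σ') {s : Fin n} (hs : σ.status s = .active) :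
    (σ.loc s).1 ≤ (σ'.loc s).1 := by
  cases h with
  | startRepair s' h' =>
    have : s ≠ s' := by rintro rfl; simp [hs] at h'
    simp [State.groupSend, this]
  | finishRepair s' c t v h' =>
    have : s ≠ s' := by rintro rfl; simp [hs] at h'
    simp [State.endCall, this]
  | serve m hm h' =>
    by_cases hsm : s = m.dst
    · subst hsm; simpa using le_newLoc _ _
    · simp [hsm]
  | _ => exact le_rfl

/-- A response of `s` to number `g` arises only when `s` serves a request with tag `t`, which lifts
its tag to at least `t`; while `s` is active this is not lost. -/
theorem Step.covered (h : Step t₀ v₀ σ e σ') {t : Tag W} {v : V} {g : ℕ} {s : Fin n}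
    (hσ : σ.Covered t g s) (hc : ∀ m ∈ σ.reqs, m.gid = g → m.body = .putData t v)
    (hs : σ.status s = .active) :
    σ'.Covered t g s := by
  obtain ⟨h1, h2⟩ := hσ
  have hle := h.loc_le hs
  cases h.netStep with
  | groupSend p q hcall hreqs hresps hgid =>
    refine ⟨fun m hm hms hg => (h1 m (hresps ▸ hm) hms hg).trans hle, fun p' c hc' hg hr => ?_⟩
    rw [hcall, Function.update_apply] at hc'
    split at hc'
    · cases hc'; simp at hr
    · exact (h2 p' c hc' hg hr).trans hle
  | endCall p hcall hreqs hresps hgid =>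
    refine ⟨fun m hm hms hg => (h1 m (hresps ▸ hm) hms hg).trans hle, fun p' c hc' hg hr => ?_⟩
    rw [hcall, Function.update_apply] at hc'
    split at hc'
    · cases hc'
    · exact (h2 p' c hc' hg hr).trans hle
  | send p s' c hc' hcall hreqs hresps hgid =>
    refine ⟨fun m hm hms hg => (h1 m (hresps ▸ hm) hms hg).trans hle, fun p' c hc' hg hr => ?_⟩
    rw [hcall, Function.update_apply] at hc'
    split at hc'
    · cases hc'; exact (h2 p c ‹_› hg hr).trans hle
    · exact (h2 p' c hc' hg hr).trans hle
  | serve m hm hact hcall hreqs hresps hloc hgid =>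
    refine ⟨fun m' hm' hms hg => ?_, fun p' c hc' hg hr => (h2 p' c (hcall ▸ hc') hg hr).trans hle⟩
    rw [hresps] at hm'
    rcases hm' with rfl | hm'
    · simp only at hms hg
      rw [hloc, hc m hm hg, hms, Function.update_self]
      exact le_newLoc_putData _ _ _
    · exact (h1 m' hm' hms hg).trans hle
  | recvResp m c hm hc' hg hcall hreqs hresps hgid =>
    refine ⟨fun m hm hms hg => (h1 m (hresps hm) hms hg).trans hle, fun p' c' hc'' hg' hr => ?_⟩
    rw [hcall, Function.update_apply] at hc''
    split at hc''
    · cases hc''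
      simp only [Function.update_apply] at hr
      split at hr
      · exact (h1 m hm (by simp_all) (hg.symm.trans hg')).trans hle
      · exact (h2 _ c hc' hg' hr).trans hle
    · exact (h2 p' c' hc'' hg' hr).trans hle
  | drop hcall hreqs hresps hgid =>
    exact ⟨fun m hm hms hg => (h1 m (hresps hm) hms hg).trans hle,
      fun p' c hc' hg hr => (h2 p' c (hcall ▸ hc') hg hr).trans hle⟩

/-- The delicate case is the end of a repair in `M`. Its query has a number from `g` on and a
majority of replies, hence a reply from `M` with a tag at least `t`, and the repaired server adopts
the maximum. Crashes are harmless since nothing is required of the pairs of inactive servers. -/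
theorem Step.stable (h : Step t₀ v₀ σ e σ') (hb : σ.Bounded) {t : Tag W} {M : Finset (Fin n)}
    {g : ℕ} (hM : n < 2 * M.card) (hσ : σ.Stable t M g) : σ'.Stable t M g := by
  obtain ⟨h0, h1, h2, h3, h4⟩ := hσ
  refine ⟨h0.trans h.nextGid_le, ?_, ?_, ?_, ?_⟩
  · intro s hs hact
    by_cases hold : σ.status s = .active
    · exact (h1 s hs hold).trans (h.loc_le hold)
    -- A server that was not active before the step can only have become active by `finishRepair`.
    cases h with
    | crash s' h' =>
      by_cases hss : s = s' <;> simp_all [State.endCall]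
    | startRepair s' h' =>
      by_cases hss : s = s' <;> simp_all [State.groupSend]
    | finishRepair s' c t' v h' hc hsent hmaj ht =>
      by_cases hss : s = s'
      · subst hss
        obtain ⟨c', hc', hg', hcar⟩ := h4 s hs h'
        cases hc.symm.trans hc'
        obtain ⟨s₁, x, hx, hle⟩ :=
          State.Stable.exists_reply ⟨h0, h1, h2, h3, h4⟩ hM hc hg' hcar hmaj
        have : t ≤ x.1 := hle
        simpa [State.endCall] using this.trans (ht.2 s₁ _ _ hx)
      · simp_all [State.endCall]
    | _ => exact absurd hact hold
  · intro m hm hms hg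
    cases h.netStep with
    | groupSend _ _ _ _ hresps | endCall _ _ _ hresps | send _ _ _ _ _ _ hresps =>
      exact h2 m (hresps ▸ hm) hms hg
    | recvResp _ _ _ _ _ _ _ hresps | drop _ _ hresps => exact h2 m (hresps hm) hms hg
    | serve m' hm' hact hcall hreqs hresps =>
      rw [hresps] at hm
      rcases hm with rfl | hm
      · exact answer_atLeast (h1 _ hms hact) _
      · exact h2 m hm hms hg
  · intro p c hc hg s hs b hb'
    cases h.netStep with
    | groupSend p' q hcall =>
      rw [hcall, Function.update_apply] at hc
      split at hc
      · cases hc; simp at hb'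
      · exact h3 p c hc hg s hs b hb'
    | endCall p' hcall =>
      rw [hcall, Function.update_apply] at hc
      split at hc
      · cases hc
      · exact h3 p c hc hg s hs b hb'
    | send p' s' c' hc' hcall =>
      rw [hcall, Function.update_apply] at hc
      split at hc
      · cases hc; exact h3 p' c' hc' hg s hs b hb'
      · exact h3 p c hc hg s hs b hb'
    | serve _ _ _ hcall | drop hcall => exact h3 p c (hcall ▸ hc) hg s hs b hb'
    | recvResp m c' hm hc' hg' hcall =>
      rw [hcall, Function.update_apply] at hc
      split at hc
      · cases hc
        simp only [Function.update_apply] at hb'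
        split at hb'
        · cases hb'
          exact h2 m hm (by simp_all) (hg'.symm ▸ hg)
        · exact h3 _ c' hc' hg s hs b hb'
      · exact h3 p c hc hg s hs b hb'
  · intro s hs hrep
    have keep (hr : σ.status s = .repair)
        (hcall : ∀ c, σ.call (.server s) = some c →
          ∃ c', σ'.call (.server s) = some c' ∧ c'.gid = c.gid) :
        ∃ c, σ'.call (.server s) = some c ∧ g ≤ c.gid ∧ σ'.Carries .repairTagData c.gid := by
      obtain ⟨c, hc, hg, hcar⟩ := h4 s hs hr
      obtain ⟨c', hc', hcc⟩ := hcall c hc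
      exact ⟨c', hc', hcc ▸ hg, hcc ▸ h.carries hcar⟩
    cases hstep : h with
    | startRepair s' h' =>
      by_cases hss : s = s'
      · subst hss
        -- The new repair call has the number `σ.nextGid`, which is at least `g` by `h0`.
        refine ⟨_, Function.update_self .., h0, ?_⟩
        exact h.carries_new (p := .server s) hb (Function.update_self ..) rfl
      · refine keep (by simpa [State.groupSend, hss] using hrep) fun c hc => ⟨c, ?_, rfl⟩
        simpa [State.groupSend, hss] using hc
    | crash s' h' =>
      by_cases hss : s = s'
      · simp [State.endCall, hss] at hrep
      · refine keep (by simpa [State.endCall, hss] using hrep) fun c hc => ⟨c, ?_, rfl⟩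
        simpa [State.endCall, hss] using hc
    | finishRepair s' _ _ _ h' =>
      by_cases hss : s = s'
      · simp [State.endCall, hss] at hrep
      · refine keep (by simpa [State.endCall, hss] using hrep) fun c hc => ⟨c, ?_, rfl⟩
        simpa [State.endCall, hss] using hc
    | send p s' c hc hs' =>
      refine keep hrep fun c' hc' => ?_
      by_cases hp : Proc.server s = p
      · subst hp
        cases hc.symm.trans hc'
        exact ⟨_, Function.update_self .., rfl⟩
      · exact ⟨c', by simpa [hp] using hc', rfl⟩
    | recvResp m c hm hc hg =>
      refine keep hrep fun c' hc' => ?_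
      by_cases hp : Proc.server s = m.dst
      · rw [hp] at hc' ⊢
        cases hc.symm.trans hc'
        exact ⟨_, Function.update_self .., rfl⟩
      · exact ⟨c', by simpa [hp] using hc', rfl⟩
    | _ =>
      refine keep hrep fun c hc => ⟨c, ?_, rfl⟩
      simpa [State.endCall, State.groupSend] using hc

end RadonL

/-! ### Origin of the pairs of tags and values -/

namespace RadonL

variable {R W V : Type*} {n : ℕ}

/-- The pair in a request, if there is one, belongs to `S`. -/
def Request.Within (S : Set (Tag W × V)) : Request W V → Prop
  | .putData t v => (t, v) ∈ S
  | _ => True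

/-- The pair in a response, if there is one, belongs to `S`, and so does some pair with the tag in
the response. -/
def Response.Within (S : Set (Tag W × V)) : Response W V → Prop
  | .tag t => ∃ v, (t, v) ∈ S
  | .tagData t v => (t, v) ∈ S
  | .ack => True

/-- All the pairs of tags and values that are stored or in transit belong to `S`. -/
structure State.Within (S : Set (Tag W × V)) (σ : State R W V n) : Prop where
  loc : ∀ s, σ.loc s ∈ S
  reqs : ∀ m ∈ σ.reqs, m.body.Within S
  resps : ∀ m ∈ σ.resps, m.body.Within S
  call : ∀ p c, σ.call p = some c → c.req.Within S
  replies : ∀ p c, σ.call p = some c → ∀ s b, c.replies s = some b → b.Within S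

theorem answer_within {S : Set (Tag W × V)} {x : Tag W × V} (h : x ∈ S) (q : Request W V) :
    (answer x q).Within S := by
  cases q
  · exact ⟨x.2, h⟩
  · exact h
  · exact h
  · trivial

theorem newLoc_mem [LinearOrder W] {S : Set (Tag W × V)} {x : Tag W × V} (h : x ∈ S)
    {q : Request W V} (hq : q.Within S) : newLoc x q ∈ S := by
  cases q with
  | putData t v =>
    by_cases hx : x.1 < t
    · simpa [newLoc, hx, Request.Within] using hq
    · simpa [newLoc, hx] using h
  | _ => exact h

/-- Apart from `startRepair`, which restores `(t₀, v₀)`, and `writerPut`, which forms a new pair,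
steps only copy pairs; `h₀` and `hput` cover these two. -/
theorem Step.within [DecidableEq R] [LinearOrder W] {t₀ : Tag W} {v₀ : V} {σ σ' : State R W V n}
    {e : Event R W V n} (h : Step t₀ v₀ σ e σ') {S : Set (Tag W × V)} (h₀ : (t₀, v₀) ∈ S)
    (hσ : σ.Within S)
    (hput : ∀ w c t v, e = .writerPut w → σ.writer w = .getTag v →
      σ.call (.writer w) = some c → c.IsMaxTag t → (toLex ((ofLex t).1 + 1, w), v) ∈ S) :
    σ'.Within S := by
  obtain ⟨h1, h2, h3, h4, h5⟩ := hσ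
  refine ⟨fun s => ?_, fun m hm => ?_, fun m hm => ?_, fun p c hc => ?_, fun p c hc s b hb => ?_⟩
  · cases h with
    | startRepair s' h' =>
      by_cases hs : s = s'
      · subst hs; simpa [State.groupSend] using h₀
      · simpa [State.groupSend, hs] using h1 s
    | finishRepair s' c t v h' hc hsent hmaj ht =>
      by_cases hs : s = s'
      · subst hs
        obtain ⟨s₁, hs₁⟩ := ht.1
        have : (t, v) ∈ S := h5 _ c hc s₁ _ hs₁
        simpa [State.endCall] using this
      · simpa [State.endCall, hs] using h1 s
    | serve m hm h' =>
      by_cases hs : s = m.dst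
      · subst hs
        simpa using newLoc_mem (h1 _) (h2 m hm)
      · simpa [hs] using h1 s
    | _ => exact h1 s
  · cases h.netStep with
    | groupSend _ _ _ hreqs | endCall _ _ hreqs | recvResp _ _ _ _ _ _ hreqs =>
      exact h2 m (hreqs ▸ hm)
    | serve _ _ _ _ hreqs | drop _ hreqs => exact h2 m (hreqs hm)
    | send p s c hc _ hreqs =>
      rw [hreqs] at hm
      rcases hm with rfl | hm
      · exact h4 p c hc
      · exact h2 m hm
  · cases h.netStep with
    | groupSend _ _ _ _ hresps | endCall _ _ _ hresps | send _ _ _ _ _ _ hresps =>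
      exact h3 m (hresps ▸ hm)
    | recvResp _ _ _ _ _ _ _ hresps | drop _ _ hresps => exact h3 m (hresps hm)
    | serve m' hm' hact hcall hreqs hresps =>
      rw [hresps] at hm
      rcases hm with rfl | hm
      · exact answer_within (h1 _) _
      · exact h3 m hm
  · have upd {p₀ : Proc R W n} {x : Option (Call W V n)}
        (hc' : Function.update σ.call p₀ x p = some c) (hx : ∀ c', x = some c' → c'.req.Within S) :
        c.req.Within S := by
      rw [Function.update_apply] at hc'
      split at hc'
      · exact hx c hc'
      · exact h4 p c hc'
    cases h with
    | invokeWrite | invokeRead | startRepair =>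
      exact upd hc (by rintro _ ⟨⟩; trivial)
    | returnWrite | returnRead | failReader | failWriter | crash | finishRepair =>
      exact upd hc (by rintro _ ⟨⟩)
    | writerPut w v c' t h' hc' hsent hmaj ht =>
      exact upd hc (by rintro _ ⟨⟩; exact hput w c' t v rfl h' hc' ht)
    | readerPut r c' t v h' hc' hsent hmaj ht =>
      obtain ⟨s₁, hs₁⟩ := ht.1
      exact upd hc (by rintro _ ⟨⟩; exact h5 _ c' hc' s₁ _ hs₁)
    | send p' s c' hc' hs => exact upd hc (by rintro _ ⟨⟩; exact h4 p' c' hc')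
    | recvResp m c' hm hc' hg => exact upd hc (by rintro _ ⟨⟩; exact h4 _ c' hc')
    | serve | ignore | dropResp => exact h4 p c hc
  · cases h.netStep with
    | groupSend p' q hcall =>
      rw [hcall, Function.update_apply] at hc
      split at hc
      · cases hc; simp at hb
      · exact h5 p c hc s b hb
    | endCall p' hcall =>
      rw [hcall, Function.update_apply] at hc
      split at hc
      · cases hc
      · exact h5 p c hc s b hb
    | send p' s' c' hc' hcall =>
      rw [hcall, Function.update_apply] at hc
      split at hc
      · cases hc; exact h5 p' c' hc' s b hb
      · exact h5 p c hc s b hb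
    | serve _ _ _ hcall | drop hcall => exact h5 p c (hcall ▸ hc) s b hb
    | recvResp m c' hm hc' hg' hcall =>
      rw [hcall, Function.update_apply] at hc
      split at hc
      · cases hc
        simp only [Function.update_apply] at hb
        split at hb
        · cases hb; exact h3 m hm
        · exact h5 _ c' hc' s b hb
      · exact h5 p c hc s b hb

/-! ### Executions and the course of an operation -/

namespace Execution

variable [DecidableEq R] [LinearOrder W] {t₀ : Tag W} {v₀ : V}

theorem invariant_of_step (β : Execution R W V n t₀ v₀) {P : State R W V n → Prop} {i : ℕ}
    (h0 : P (β.state i))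
    (hstep : ∀ k e, i ≤ k → β.event k = some e → Step t₀ v₀ (β.state k) e (β.state (k + 1)) →
      P (β.state k) → P (β.state (k + 1))) {k : ℕ} (hk : i ≤ k) : P (β.state k) := by
  induction k, hk using Nat.le_induction with
  | base => exact h0
  | succ k hk ih =>
    cases he : β.event k with
    | none => rw [β.stutter k he]; exact ih
    | some e => exact hstep k e hk he (β.step k e he) ih

theorem bounded (β : Execution R W V n t₀ v₀) (k : ℕ) : (β.state k).Bounded :=
  β.invariant_of_step (i := 0)
    (by rw [β.start]; exact ⟨by simp [State.initial], by simp [State.initial],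
      by simp [State.initial]⟩)
    (fun _ _ _ _ h hk => h.bounded hk) (Nat.zero_le k)

theorem nextGid_mono (β : Execution R W V n t₀ v₀) {i k : ℕ} (h : i ≤ k) :
    (β.state i).nextGid ≤ (β.state k).nextGid :=
  β.invariant_of_step (P := fun σ => (β.state i).nextGid ≤ σ.nextGid) le_rfl
    (fun _ _ _ _ h hk => hk.trans h.nextGid_le) h

theorem carries_of_le (β : Execution R W V n t₀ v₀) {q : Request W V} {g i k : ℕ}
    (h : (β.state i).Carries q g) (hik : i ≤ k) : (β.state k).Carries q g :=
  β.invariant_of_step (P := fun σ => σ.Carries q g) h (fun _ _ _ _ h hk => h.carries hk) hik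

/-- A call that did not exist before carries its message. -/
theorem carries_new (β : Execution R W V n t₀ v₀) {i : ℕ} {p : Proc R W n} {c : Call W V n}
    (hc : (β.state (i + 1)).call p = some c) (hg : c.gid = (β.state i).nextGid) :
    (β.state (i + 1)).Carries c.req c.gid := by
  cases he : β.event i with
  | none =>
    rw [β.stutter i he] at hc
    exact absurd hg ((β.bounded i).call p c hc).ne
  | some e => exact (β.step i e he).carries_new (β.bounded i) hc hg

theorem clientStep (β : Execution R W V n t₀ v₀) (k : ℕ) (p : R ⊕ W) :
    ClientStep (β.state k) (β.history k) ((β.event k).bind Event.groupSender)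
      (β.state (k + 1)) p := by
  cases he : β.event k with
  | none =>
    have hs := β.stutter k he
    exact .other (by rw [hs]) (fun c hc => ⟨c, by rw [hs]; exact hc, rfl⟩) (by simp [history, he])
  | some e => simpa [history, he] using (β.step k e he).clientStep p

/-- The operation invoked by the action `a` at step `i` is in its first phase until step `k`. -/
def Querying (β : Execution R W V n t₀ v₀) (a : RWAction R W V) (i k : ℕ) : Prop :=
  β.history i = some a ∧ a.IsInv ∧ i < k ∧
    ∀ m, i < m → m ≤ k → (β.state m).phase a.client = .get a.written

/-- The operation invoked by the action `a` at step `i` begins its `put-data` phase, with the pair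
`(t, v)`, at step `q`. -/
def PutAt (β : Execution R W V n t₀ v₀) (a : RWAction R W V) (i q : ℕ) (t : Tag W) (v : V) : Prop :=
  β.Querying a i q ∧ (β.state (q + 1)).phase a.client = .put t v

variable {β : Execution R W V n t₀ v₀} {a : RWAction R W V} {i k q : ℕ} {t : Tag W} {v : V}

/-- The effect of an invocation. -/
theorem phase_of_inv (ha : β.history i = some a) (hinv : a.IsInv) :
    (β.state i).phase a.client = .idle ∧
      (β.state (i + 1)).phase a.client = .get a.written ∧
      (β.state (i + 1)).call (clientProc n a.client) =
        some ⟨(β.state i).nextGid, clientQuery V a.client, Finset.univ, fun _ => none⟩ := by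
  cases β.clientStep i a.client with
  | other hphase hcall haction => exact absurd rfl (haction a ha)
  | invoke a' haction hp hinv' hphase hphase' hcall =>
    cases ha.symm.trans haction
    exact ⟨hphase, hphase', hcall⟩
  | put x t v c haction => simp [ha] at haction
  | respond a' t v c haction hp hinv' =>
    cases ha.symm.trans haction
    exact absurd hinv hinv'
  | fail haction => simp [ha] at haction

/-- As long as the phase stays `get`, only the case `other` of `ClientStep` is possible, and it
preserves the number of the call issued at step `i`. -/
theorem Querying.exists_call (h : β.Querying a i k) :
    ∃ c, (β.state k).call (clientProc n a.client) = some c ∧ c.gid = (β.state i).nextGid ∧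
      (β.state k).Carries (clientQuery V a.client) c.gid := by
  obtain ⟨ha, hinv, hik, hget⟩ := h
  obtain ⟨-, -, hcall⟩ := phase_of_inv ha hinv
  have hcar := β.carries_new hcall rfl
  suffices ∃ c, (β.state k).call (clientProc n a.client) = some c ∧
      c.gid = (β.state i).nextGid by
    obtain ⟨c, hc, hg⟩ := this
    exact ⟨c, hc, hg, hg ▸ β.carries_of_le hcar hik⟩
  induction k, (hik : i + 1 ≤ k) using Nat.le_induction with
  | base => exact ⟨_, hcall, rfl⟩
  | succ k hk ih =>
    obtain ⟨c, hc, hg⟩ := ih fun m hm hmk => hget m hm (by omega)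
    have h1 := hget k hk (by omega)
    have h2 := hget (k + 1) (by omega) le_rfl
    cases β.clientStep k a.client with
    | other _ hcall' _ =>
      obtain ⟨c', hc', hg'⟩ := hcall' c hc
      exact ⟨c', hc', hg'.trans hg⟩
    | invoke _ _ _ _ hphase => simp [h1] at hphase
    | put _ _ _ _ _ _ _ hphase' => simp [h2] at hphase'
    | respond _ _ _ _ _ _ _ hphase => simp [h1] at hphase
    | fail _ hphase' => simp [h2] at hphase'

/-- The effect of the beginning of a `put-data` phase. -/
theorem PutAt.exists_call (h : β.PutAt a i q t v) :
    ∃ c, (β.state q).call (clientProc n a.client) = some c ∧ c.gid = (β.state i).nextGid ∧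
      (β.state q).Carries (clientQuery V a.client) c.gid ∧ c.Majority ∧
      Selects c t v a.written a.client ∧
      (β.event q).bind Event.groupSender = some (clientProc n a.client) ∧
      (β.state (q + 1)).call (clientProc n a.client) =
        some ⟨(β.state q).nextGid, .putData t v, Finset.univ, fun _ => none⟩ := by
  obtain ⟨hq, hput⟩ := h
  obtain ⟨c, hc, hg, hcar⟩ := hq.exists_call
  have hget := hq.2.2.2 q hq.2.2.1 le_rfl
  refine ⟨c, hc, hg, hcar, ?_⟩
  cases β.clientStep q a.client with
  | other hphase => simp [hget, hput] at hphase
  | invoke _ _ _ _ hphase => simp [hget] at hphase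
  | put x t' v' c' _ hsender hphase hphase' hcall hmaj hsel hcall' =>
    cases hc.symm.trans hcall
    cases hget.symm.trans hphase
    cases hput.symm.trans hphase'
    exact ⟨hmaj, hsel, hsender, hcall'⟩
  | respond _ _ _ _ _ _ _ hphase => simp [hget] at hphase
  | fail _ hphase' => simp [hput] at hphase'

theorem PutAt.unique {a' : RWAction R W V} {q' : ℕ} {t' : Tag W} {v' : V}
    (h : β.PutAt a i q t v) (h' : β.PutAt a' i q' t' v') : t' = t ∧ v' = v := by
  obtain ⟨⟨ha, hinv, hiq, hget⟩, hput⟩ := h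
  obtain ⟨⟨ha', -, hiq', hget'⟩, hput'⟩ := h'
  cases ha.symm.trans ha'
  rcases lt_trichotomy q q' with hlt | rfl | hlt
  -- At `q + 1` the client would be in both phases at once.
  · simp [hget' (q + 1) (by omega) hlt] at hput
  · cases hput.symm.trans hput'
    exact ⟨rfl, rfl⟩
  · simp [hget (q' + 1) (by omega) hlt] at hput'

/-- The call of a client in its `put-data` phase is the one with which the phase began. -/
theorem PutAt.exists_call_of_put (h : β.PutAt a i q t v) {j : ℕ} (hqj : q < j)
    (hput : ∀ m, q < m → m ≤ j → (β.state m).phase a.client = .put t v) :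
    ∃ c, (β.state j).call (clientProc n a.client) = some c ∧ c.gid = (β.state q).nextGid := by
  obtain ⟨-, -, -, -, -, -, -, hcall⟩ := h.exists_call
  induction j, (hqj : q + 1 ≤ j) using Nat.le_induction with
  | base => exact ⟨_, hcall, rfl⟩
  | succ k hk ih =>
    obtain ⟨c, hc, hg⟩ := ih fun m hm hmk => hput m hm (by omega)
    have h1 := hput k hk (by omega)
    have h2 := hput (k + 1) (by omega) le_rfl
    cases β.clientStep k a.client with
    | other _ hcall' _ =>
      obtain ⟨c', hc', hg'⟩ := hcall' c hc
      exact ⟨c', hc', hg'.trans hg⟩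
    | invoke _ _ _ _ hphase => simp [h1] at hphase
    | put _ _ _ _ _ _ hphase => simp [h1] at hphase
    | respond _ _ _ _ _ _ _ _ hphase' => simp [h2] at hphase'
    | fail _ hphase' => simp [h2] at hphase'

/-- The course of an operation as long as its client takes no further external action. -/
theorem phase_cases (ha : β.history i = some a) (hinv : a.IsInv) (hik : i < k)
    (hno : ∀ m, i < m → m < k → ∀ d : RWAction R W V, β.history m = some d →
      d.client ≠ a.client) :
    β.Querying a i k ∨
      (∃ q t v, β.PutAt a i q t v ∧ q < k ∧
        ∀ m, q < m → m ≤ k → (β.state m).phase a.client = .put t v) ∨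
      (β.state k).phase a.client = .failed := by
  induction k, (hik : i + 1 ≤ k) using Nat.le_induction with
  | base =>
    refine Or.inl ⟨ha, hinv, by omega, fun m hm hm' => ?_⟩
    obtain rfl : m = i + 1 := by omega
    exact (phase_of_inv ha hinv).2.1
  | succ k hk ih =>
    have hclient := hno k hk (Nat.lt_succ_self k)
    cases β.clientStep k a.client with
    | other hphase =>
      rcases ih fun m hm hmk => hno m hm (by omega) with hq | ⟨q, t, v, hq, hqk, hput⟩ | hf
      · refine Or.inl ⟨ha, hinv, by omega, fun m hm hm' => ?_⟩
        rcases hm'.lt_or_eq with hm' | rfl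
        · exact hq.2.2.2 m hm (by omega)
        · exact hphase.trans (hq.2.2.2 k hk le_rfl)
      · refine Or.inr (Or.inl ⟨q, t, v, hq, by omega, fun m hm hm' => ?_⟩)
        rcases hm'.lt_or_eq with hm' | rfl
        · exact hput m hm (by omega)
        · exact hphase.trans (hput k hqk le_rfl)
      · exact Or.inr (Or.inr (hphase.trans hf))
    | invoke a' haction hp => exact absurd hp (hclient a' haction)
    | put x t v c _ _ hphase hphase' =>
      rcases ih fun m hm hmk => hno m hm (by omega) with hq | ⟨q, t', v', hq, hqk, hput⟩ | hf
      · refine Or.inr (Or.inl ⟨k, t, v, ⟨hq, hphase'⟩, Nat.lt_succ_self k, fun m hm hm' => ?_⟩)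
        obtain rfl : m = k + 1 := by omega
        exact hphase'
      · simp [hput k hqk le_rfl] at hphase
      · simp [hf] at hphase
    | respond a' _ _ _ haction hp => exact absurd hp (hclient a' haction)
    | fail _ hphase' => exact Or.inr (Or.inr hphase')

/-- A complete operation goes through its two phases, and the second one ends with a quorum. -/
theorem exists_putAt_of_completes {j : ℕ} (h : β.history.Completes i j) :
    ∃ a q t v c, β.PutAt a i q t v ∧ q < j ∧
      (β.state j).call (clientProc n a.client) = some c ∧ c.gid = (β.state q).nextGid ∧
      c.Sent ∧ c.PutQuorum ∧ ∀ r u, β.history j = some (.retRead r u) →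
        a.client = .inl r ∧ u = v := by
  obtain ⟨hij, a, b, ha, hb, hinv, hret, hclient, hno⟩ := h
  cases β.clientStep j a.client with
  | other _ _ haction => exact absurd hclient (haction b hb)
  | invoke a' haction _ hinv' =>
    cases hb.symm.trans haction
    exact absurd hinv' hret
  | put _ _ _ _ haction => simp [hb] at haction
  | fail haction => simp [hb] at haction
  | respond b' t v c haction hp _ hphase hphase' hcall hsent hquorum hvalue =>
    rcases phase_cases ha hinv hij hno with hq | ⟨q, t', v', hq, hqj, hput⟩ | hf
    · simp [hq.2.2.2 j hij le_rfl] at hphase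
    · cases (hput j hqj le_rfl).symm.trans hphase
      obtain ⟨c', hc', hg⟩ := hq.exists_call_of_put hqj hput
      cases hcall.symm.trans hc'
      refine ⟨a, q, t, v, c, hq, hqj, hcall, hg, hsent, hquorum, fun r u hu => ?_⟩
      cases hb.symm.trans haction
      cases hb.symm.trans hu
      exact ⟨hclient.symm, hvalue r u rfl⟩
    · simp [hf] at hphase

/-- A client that invokes a second operation has completed the first one. -/
theorem exists_completes_of_inv {b : RWAction R W V} (ha : β.history i = some a) (hainv : a.IsInv)
    (hb : β.history k = some b) (hbinv : b.IsInv) (hclient : b.client = a.client) (hik : i < k) :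
    ∃ j, j ≤ k ∧ β.history.Completes i j := by
  classical
  by_cases hex : ∃ m, (i < m ∧ m < k) ∧ ∃ d, β.history m = some d ∧ d.client = a.client
  · let m := Nat.find hex
    obtain ⟨⟨him, hmk⟩, d, hd, hda⟩ := Nat.find_spec hex
    have hno : ∀ l, i < l → l < m → ∀ d : RWAction R W V, β.history l = some d →
        d.client ≠ a.client := fun l hil hlm d hd hda =>
      Nat.find_min hex hlm ⟨⟨hil, hlm.trans hmk⟩, d, hd, hda⟩
    refine ⟨m, hmk.le, him, a, d, ha, hd, hainv, fun hdinv => ?_, hda, hno⟩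
    have hidle := (phase_of_inv hd hdinv).1
    rw [hda] at hidle
    rcases phase_cases ha hainv him hno with hq | ⟨q, t', v', hq, hqj, hput⟩ | hf
    · simp [hq.2.2.2 _ him le_rfl] at hidle
    · simp [hput _ hqj le_rfl] at hidle
    · simp [hf] at hidle
  · have hno : ∀ l, i < l → l < k → ∀ d : RWAction R W V, β.history l = some d →
        d.client ≠ a.client := fun l hil hlm d hd hda => hex ⟨l, ⟨hil, hlm⟩, d, hd, hda⟩
    have hidle := (phase_of_inv hb hbinv).1
    rw [hclient] at hidle
    rcases phase_cases ha hainv hik hno with hq | ⟨q, t', v', hq, hqj, hput⟩ | hf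
    · simp [hq.2.2.2 _ hik le_rfl] at hidle
    · simp [hput _ hqj le_rfl] at hidle
    · simp [hf] at hidle

/-- A client in its first phase has invoked an operation. -/
theorem exists_querying {p : R ⊕ W} {x : Option V} (h : (β.state k).phase p = .get x) :
    ∃ a i, a.client = p ∧ a.written = x ∧ β.Querying a i k := by
  induction k with
  | zero =>
    rw [β.start] at h
    cases p <;> simp [State.initial, State.phase, ReaderPhase.toClient,
      WriterPhase.toClient] at h
  | succ k ih =>
    cases β.clientStep k p with
    | other hphase =>
      obtain ⟨a, i, rfl, rfl, ha, hinv, hik, hget⟩ := ih (hphase ▸ h)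
      refine ⟨a, i, rfl, rfl, ha, hinv, by omega, fun m hm hm' => ?_⟩
      rcases hm'.lt_or_eq with hm' | rfl
      · exact hget m hm (by omega)
      · exact h
    | invoke a haction hp hinv _ hphase' =>
      subst hp
      cases h.symm.trans hphase'
      refine ⟨a, k, rfl, rfl, haction, hinv, Nat.lt_succ_self k, fun m hm hm' => ?_⟩
      obtain rfl : m = k + 1 := by omega
      exact h
    | put _ _ _ _ _ _ _ hphase' => simp [h] at hphase'
    | respond _ _ _ _ _ _ _ _ hphase' => simp [h] at hphase'
    | fail _ hphase' => simp [h] at hphase'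

end Execution

end RadonL

/-! ### Quorums, persistence and the order of tags -/

namespace RadonL

theorem lt_nextTag {W : Type*} [LinearOrder W] {t t' : Tag W} (h : t ≤ t') (w : W) :
    t < toLex ((ofLex t').1 + 1, w) :=
  h.trans_lt (Prod.Lex.lt_iff.2 (Or.inl (Nat.lt_succ_self _)))

/-- A put quorum meets every set of more than three quarters of the servers in a majority. -/
theorem Call.PutQuorum.lt_two_mul_card_inter {W V : Type*} {n : ℕ} {α : ℝ} {c : Call W V n}
    (hc : c.PutQuorum) (hα : 3 / 4 < α) {A : Finset (Fin n)} (hA : A.card = ⌈α * (n : ℝ)⌉₊) :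
    n < 2 * (A ∩ c.responders).card := by
  have h1 := Finset.card_union_add_card_inter A c.responders
  have h2 := Finset.card_le_univ (A ∪ c.responders)
  have h3 := Finset.card_le_univ c.responders
  rw [Fintype.card_fin] at h2 h3
  have h4 : 3 * n + 1 ≤ 4 * c.responders.card := by
    have := (Nat.le_ceil ((3 * (n : ℝ) + 1) / 4)).trans (Nat.cast_le.2 hc)
    have : 3 * (n : ℝ) + 1 ≤ 4 * c.responders.card := by linarith
    exact_mod_cast this
  -- A quorum cannot exist for `n = 0`; positivity makes `3n/4 < αn` strict.
  have hn : (0 : ℝ) < n := by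
    have : 0 < n := by omega
    exact_mod_cast this
  have h5 : 3 * n < 4 * A.card := by
    have := Nat.le_ceil (α * (n : ℝ))
    rw [← hA] at this
    have : 3 * (n : ℝ) < 4 * A.card := by nlinarith
    exact_mod_cast this
  -- Both sets have at least `(3n + 1)/4` elements, so they share at least `(n + 1)/2`.
  omega

namespace Execution

variable {R W V : Type*} {n : ℕ} [DecidableEq R] [LinearOrder W] {t₀ : Tag W} {v₀ : V}
  {β : Execution R W V n t₀ v₀} {a : RWAction R W V} {i j k q : ℕ} {t : Tag W} {v : V}

/-- All the requests of the group-send operation of a `put-data` phase carry its pair. -/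
theorem PutAt.body_eq (h : β.PutAt a i q t v) {m : ReqMsg R W V n} (hm : m ∈ (β.state k).reqs)
    (hg : m.gid = (β.state q).nextGid) : q < k ∧ m.body = .putData t v := by
  have hqk : q < k := by
    by_contra hcon
    have h1 := (β.bounded k).reqs m hm
    have h2 := β.nextGid_mono (not_lt.1 hcon)
    omega
  obtain ⟨-, -, -, -, -, -, -, hcall⟩ := h.exists_call
  exact ⟨hqk, (β.carries_of_le (β.carries_new hcall rfl) hqk).reqs m hm hg⟩

theorem loc_le {s : Fin n} (hik : i ≤ k)
    (hact : ∀ m, i ≤ m → m ≤ k → (β.state m).status s = .active) :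
    ((β.state i).loc s).1 ≤ ((β.state k).loc s).1 := by
  induction k, hik using Nat.le_induction with
  | base => exact le_rfl
  | succ k hk ih =>
    refine (ih fun m hm hmk => hact m hm (by omega)).trans ?_
    cases he : β.event k with
    | none => rw [β.stutter k he]
    | some e => exact (β.step k e he).loc_le (hact k hk (Nat.le_succ k))

/-- A server that is active since the beginning of a `put-data` phase and has answered has a tag at
least as large as the one put. -/
theorem PutAt.covered (h : β.PutAt a i q t v) {s : Fin n} (hqk : q ≤ k)
    (hact : ∀ m, q ≤ m → m ≤ k → (β.state m).status s = .active) :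
    (β.state k).Covered t (β.state q).nextGid s := by
  induction k, hqk using Nat.le_induction with
  | base =>
    exact ⟨fun m hm _ hg => absurd hg ((β.bounded q).resps m hm).ne,
      fun p c hc hg _ => absurd hg ((β.bounded q).call p c hc).ne⟩
  | succ k hk ih =>
    have hcov := ih fun m hm hmk => hact m hm (by omega)
    cases he : β.event k with
    | none => rw [β.stutter k he]; exact hcov
    | some e =>
      exact (β.step k e he).covered hcov (fun m hm hg => (h.body_eq hm hg).2)
        (hact k hk (Nat.le_succ k))

/-- A server that has consumed the message of a `put-data` phase has a tag at least as large as the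
one put. -/
theorem PutAt.le_loc_of_consumesAt (h : β.PutAt a i q t v) {s : Fin n}
    (hcons : β.ConsumesAt k s (β.state q).nextGid) :
    q < k ∧ t ≤ ((β.state (k + 1)).loc s).1 := by
  obtain ⟨hact, m, he, rfl, hg⟩ := hcons
  have hstep := β.step k _ he
  generalize β.state (k + 1) = σ' at hstep
  cases hstep with
  | serve _ hm h' =>
    obtain ⟨hqk, hbody⟩ := h.body_eq hm hg
    refine ⟨hqk, ?_⟩
    simpa [hbody] using le_newLoc_putData _ _ _
  | ignore _ hm h' => exact absurd hact h'

/-- Before a `put-data` phase ends with a quorum, there is a moment when a majority of the servers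
are active and have tags at least as large as the one put. -/
theorem PutAt.exists_majority {α : ℝ} (hα : 3 / 4 < α) (hN1 : β.N1 α) (h : β.PutAt a i q t v)
    {c : Call W V n} (hqj : q < j) (hcall : (β.state j).call (clientProc n a.client) = some c)
    (hg : c.gid = (β.state q).nextGid) (hsent : c.Sent) (hquorum : c.PutQuorum) :
    ∃ (T : ℕ) (M : Finset (Fin n)), T ≤ j ∧ n < 2 * M.card ∧
      ∀ s ∈ M, (β.state T).status s = .active ∧ t ≤ ((β.state T).loc s).1 := by
  obtain ⟨-, -, -, -, -, -, hsender, -⟩ := h.exists_call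
  obtain ⟨A, τ, hA, hcons, hact⟩ := hN1 q _ _ ⟨hsender, rfl⟩ ⟨j, c, hcall, hg, hsent⟩
  have hcard := hquorum.lt_two_mul_card_inter hα hA
  -- If a consumption is still due at step `j`, N1 keeps all of `A` active up to `j`, and the acks
  -- count. Otherwise all of `A` has consumed the message, and the moment right after the last
  -- consumption serves.
  by_cases hlate : ∃ s' ∈ A, j ≤ τ s'
  · obtain ⟨s', hs', hj⟩ := hlate
    refine ⟨j, A ∩ c.responders, le_rfl, hcard, fun s hs => ?_⟩
    rw [Finset.mem_inter, Call.responders, Finset.mem_filter] at hs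
    have hact' : ∀ m, q ≤ m → m ≤ j → (β.state m).status s = .active := fun m hm hmj =>
      hact s hs.1 s' hs' m hm (by omega)
    exact ⟨hact' j hqj.le le_rfl, (h.covered hqj.le hact').replies _ c hcall hg hs.2.2⟩
  · push Not at hlate
    have hle : (A ∩ c.responders).card ≤ A.card := Finset.card_le_card Finset.inter_subset_left
    obtain ⟨s', hs', hmax⟩ := A.exists_max_image τ (Finset.card_pos.1 (by omega))
    refine ⟨τ s' + 1, A, hlate s' hs', by omega, fun s hs => ?_⟩
    obtain ⟨hq, hloc⟩ := h.le_loc_of_consumesAt (hcons s hs)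
    have hτ := hmax s hs
    exact ⟨hact s hs s' hs' _ (by omega) le_rfl, hloc.trans (loc_le (by omega)
      fun m hm hmT => hact s hs s' hs' m (by omega) hmT)⟩

/-- Once a majority of the servers are active and have tags of at least `t`, this is stable. -/
theorem stable_of_majority {M : Finset (Fin n)} (hM : n < 2 * M.card)
    (h : ∀ s ∈ M, (β.state i).status s = .active ∧ t ≤ ((β.state i).loc s).1) (hik : i ≤ k) :
    (β.state k).Stable t M (β.state i).nextGid := by
  refine β.invariant_of_step (P := fun σ => σ.Stable t M (β.state i).nextGid) ?_
    (fun k _ _ _ hstep hσ => hstep.stable (β.bounded k) hM hσ) hik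
  -- At step `i` all numbers in use are below `nextGid`, so the clauses on responses and replies are
  -- vacuous; no server of `M` is in repair.
  refine ⟨le_rfl, fun s hs _ => (h s hs).2,
    fun m hm _ hg => absurd hg ((β.bounded i).resps m hm).not_ge,
    fun p c hc hg => absurd hg ((β.bounded i).call p c hc).not_ge, fun s hs hrep => ?_⟩
  rw [(h s hs).1] at hrep
  cases hrep

/-- The tag of an operation is at least as large as that of an operation completed before its
invocation, and larger if it is a write. -/
theorem PutAt.tag_le_of_completes {α : ℝ} (hα : 3 / 4 < α) (hN1 : β.N1 α)
    (hij : β.history.Completes i j) (h : β.PutAt a i q t v) {b : RWAction R W V} {l q' : ℕ}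
    {t' : Tag W} {v' : V} (h' : β.PutAt b l q' t' v') (hjl : j ≤ l) :
    t ≤ t' ∧ ∀ w u, b = .invWrite w u → t < t' := by
  obtain ⟨a₁, q₁, t₁, v₁, c₁, h₁, hqj, hcall, hg, hsent, hquorum, -⟩ :=
    exists_putAt_of_completes hij
  obtain ⟨rfl, rfl⟩ := h.unique h₁
  obtain ⟨T, M, hTj, hM, hT⟩ := h₁.exists_majority hα hN1 hqj hcall hg hsent hquorum
  obtain ⟨c, hc, hcg, hcar, hmaj, hsel, -⟩ := h'.exists_call
  have hlq : l < q' := h'.1.2.2.1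
  have hst := stable_of_majority hM hT (k := q') (by omega)
  -- The query of the later operation is issued at `l`, not before `T`, so stability applies to its
  -- replies.
  have hgid : (β.state T).nextGid ≤ c.gid := hcg ▸ β.nextGid_mono (hTj.trans hjl)
  obtain ⟨s, x, hx, hle⟩ := hst.exists_reply hM hc hgid hcar hmaj
  have hinv := h'.1.2.1
  cases b with
  | invRead r =>
    exact ⟨le_trans hle (hsel.2 s _ _ hx), by simp⟩
  | invWrite w u =>
    obtain ⟨-, t₂, ht₂, rfl⟩ := hsel
    have := lt_nextTag (le_trans hle (ht₂.2 s _ hx)) w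
    exact ⟨this.le, fun _ _ _ => this⟩
  | retRead => exact absurd hinv id
  | retWrite => exact absurd hinv id

/-! ### Tags and values of writes and reads -/

/-- The pairs that occur in an execution: the initial one and those of the writes. -/
def pairs (β : Execution R W V n t₀ v₀) : Set (Tag W × V) :=
  {x | x = (t₀, v₀) ∨ t₀ < x.1 ∧ ∃ l q w, β.PutAt (.invWrite w x.2) l q x.1 x.2}

theorem le_of_mem_pairs {x : Tag W × V} (h : x ∈ β.pairs) : t₀ ≤ x.1 := by
  rcases h with rfl | ⟨h, -⟩
  · exact le_rfl
  · exact h.le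

theorem within_pairs (β : Execution R W V n t₀ v₀) (k : ℕ) : (β.state k).Within β.pairs := by
  refine β.invariant_of_step (i := 0) ?_ ?_ (Nat.zero_le k)
  · rw [β.start]
    exact ⟨fun _ => Or.inl rfl, by simp [State.initial], by simp [State.initial],
      by simp [State.initial], by simp [State.initial]⟩
  · intro k e _ he hstep hσ
    refine hstep.within (Or.inl rfl) hσ ?_
    rintro w c t v rfl hget hc ⟨⟨s, hs⟩, hmax⟩
    obtain ⟨v', hv'⟩ := hσ.replies _ c hc s _ hs
    -- `t₀` need not be the least tag; new tags exceed it because by induction every tag received is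
    -- at least `t₀`.
    refine Or.inr ⟨lt_nextTag (le_of_mem_pairs hv') w, ?_⟩
    have hphase : (β.state k).phase (.inr w) = .get (some v) := by
      simp [State.phase, hget, WriterPhase.toClient]
    obtain ⟨a, i, ha, hav, hq⟩ := exists_querying hphase
    have hinv := hq.2.1
    cases a with
    | invWrite w' u =>
      cases ha; cases hav
      refine ⟨i, k, w, hq, ?_⟩
      generalize β.state (k + 1) = σ' at hstep
      cases hstep with
      | writerPut _ v₁ c₁ t₁ h₁ hc₁ _ _ ht₁ =>
        cases hget.symm.trans h₁
        cases hc.symm.trans hc₁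
        -- The step has its own witness for the largest tag; the maximum is unique.
        obtain rfl : t = t₁ := le_antisymm (ht₁.2 s t hs) (by
          obtain ⟨s₁, hs₁⟩ := ht₁.1
          exact hmax s₁ t₁ hs₁)
        simp [State.phase, State.groupSend, RWAction.client, WriterPhase.toClient]
    | invRead => cases ha
    | retRead => exact absurd hinv id
    | retWrite => exact absurd hinv id

/-- The strict inequality separates the writes from the initial value, and the second component
makes tags of different writers distinct. -/
theorem PutAt.lt_of_write {w : W} {u : V} (h : β.PutAt (.invWrite w u) i q t v) :
    t₀ < t ∧ (ofLex t).2 = w := by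
  obtain ⟨c, hc, -, -, -, hsel, -⟩ := h.exists_call
  obtain ⟨-, t', ⟨⟨s, hs⟩, -⟩, rfl⟩ := hsel
  obtain ⟨v', hv'⟩ := (β.within_pairs q).replies _ c hc s _ hs
  exact ⟨lt_nextTag (le_of_mem_pairs hv') w, rfl⟩

theorem PutAt.mem_pairs_of_read {r : R} (h : β.PutAt (.invRead r) i q t v) : (t, v) ∈ β.pairs := by
  obtain ⟨c, hc, -, -, -, hsel, -⟩ := h.exists_call
  obtain ⟨⟨s, hs⟩, -⟩ := hsel
  exact (β.within_pairs q).replies _ c hc s _ hs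

/-- Two writes with the same tag are the same operation. -/
theorem PutAt.eq_of_tag_eq {α : ℝ} (hα : 3 / 4 < α) (hN1 : β.N1 α) {w w' : W} {u u' v' : V}
    {q' : ℕ} (h : β.PutAt (.invWrite w u) i q t v) (h' : β.PutAt (.invWrite w' u') k q' t v') :
    i = k := by
  wlog hik : i < k generalizing i k w w' u u' v v' q q'
  · rcases (not_lt.1 hik).lt_or_eq with hki | hki
    · exact (this h' h hki).symm
    · exact hki.symm
  -- The tag names its writer, and the writer has completed the earlier write before it invokes the
  -- later one.
  obtain rfl : w = w' := h.lt_of_write.2.symm.trans h'.lt_of_write.2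
  obtain ⟨j, hjk, hj⟩ := exists_completes_of_inv h.1.1 h.1.2.1 h'.1.1 h'.1.2.1 rfl hik
  exact absurd ((PutAt.tag_le_of_completes hα hN1 hj h h' hjk).2 w u' rfl) (lt_irrefl t)

end Execution

end RadonL

/-! ### Conclusion -/

theorem theorem3 {R W V : Type*} {n : ℕ} [DecidableEq R] [LinearOrder W]
    (t₀ : RadonL.Tag W) (v₀ : V) (α : ℝ) (hα : 3 / 4 < α)
    (β : RadonL.Execution R W V n t₀ v₀) (hN1 : β.N1 α) :
    β.history.Atomic v₀ := by
  classical
  let P : Set ℕ := {i | ∃ t a q v, β.PutAt a i q t v}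
  -- The tag is determined by the operation (`PutAt.unique`); the value `t₀` outside `P` plays no
  -- role.
  let tag : ℕ → RadonL.Tag W := fun i => if h : i ∈ P then h.choose else t₀
  have htag {a i q t v} (h : β.PutAt a i q t v) : tag i = t := by
    have hi : i ∈ P := ⟨t, a, q, v, h⟩
    obtain ⟨a', q', v', h'⟩ := hi.choose_spec
    simp only [tag, dif_pos hi]
    exact (h.unique h').1
  have hwrite {a i q t v u} (h : β.PutAt a i q t v) (hu : β.history.WriteAt i u) :
      ∃ w, a = .invWrite w u := by
    obtain ⟨w, hw⟩ := hu
    exact ⟨w, Option.some.inj (h.1.1.symm.trans hw)⟩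
  refine RWHistory.atomic_of_tags P tag ?_ ?_ ?_ ?_ ?_ ?_
  · rintro i ⟨t, a, q, v, h⟩
    exact ⟨a, h.1.1, h.1.2.1⟩
  · intro i j hij
    obtain ⟨a, q, t, v, -, h, -⟩ := RadonL.Execution.exists_putAt_of_completes hij
    exact ⟨t, a, q, v, h⟩
  · rintro i j l hij ⟨t', b, q', v', h'⟩ hjl
    obtain ⟨a, q, t, v, -, h, -⟩ := RadonL.Execution.exists_putAt_of_completes hij
    rw [htag h, htag h']
    exact (h.tag_le_of_completes hα hN1 hij h' hjl).1
  · rintro i j l u hij ⟨t', b, q', v', h'⟩ hjl hu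
    obtain ⟨a, q, t, v, -, h, -⟩ := RadonL.Execution.exists_putAt_of_completes hij
    obtain ⟨w, hw⟩ := hwrite h' hu
    rw [htag h, htag h']
    exact (h.tag_le_of_completes hα hN1 hij h' hjl).2 w u hw
  · rintro k ⟨t, a, q, v, h⟩ l ⟨t', b, q', v', h'⟩ u u' hu hu' heq
    obtain ⟨w, rfl⟩ := hwrite h hu
    obtain ⟨w', rfl⟩ := hwrite h' hu'
    rw [htag h, htag h'] at heq
    subst heq
    exact h.eq_of_tag_eq hα hN1 h'
  · intro i j r v hij hj
    obtain ⟨a, q, t, v', c, h, -, -, -, -, -, hret⟩ :=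
      RadonL.Execution.exists_putAt_of_completes hij
    obtain ⟨hclient, rfl⟩ := hret r v hj
    have hinv := h.1.2.1
    cases a with
    | invWrite => cases hclient
    | retRead => exact absurd hinv id
    | retWrite => exact absurd hinv id
    | invRead r' =>
      rw [htag h]
      -- Either the read has the initial pair, and all writes have larger tags, or its pair was put
      -- by a write, possibly an incomplete one.
      rcases h.mem_pairs_of_read with heq | ⟨-, l, q', w, hl⟩
      · obtain ⟨rfl, rfl⟩ := Prod.mk.inj heq
        refine Or.inr ⟨rfl, ?_⟩
        rintro l ⟨t', b, q', v', h'⟩ u hu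
        obtain ⟨w, rfl⟩ := hwrite h' hu
        rw [htag h']
        exact h'.lt_of_write.1
      · exact Or.inl ⟨l, ⟨_, _, _, _, hl⟩, ⟨w, hl.1.1⟩, htag hl⟩
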